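/- Let $P_\bullet=(P_{k,\pm})_{k\ge 0}$ be a shaded planar algebra over $\mathbb C$ of modulus $\delta\in\mathbb C$: planar tangles act multilinearly on the spaces $P_{k,\pm}$, compatibly with isotopy and composition, and every contractible closed loop (of either shading) may be replaced by the factor $\delta$. The sign records the shading of the region at the distinguished boundary interval $\star$ ($+$ for unshaded, $-$ for shaded), and elements of $P_{k,\pm}$ have $2k$ boundary points. Let $TL_{k,\pm}\subseteq P_{k,\pm}$ be the Temperley–Lieb subspace, spanned by the tangles without input discs. Draw a $2$-box as a rectangle with two strings at the top, two at the bottom and, unless said otherwise, $\star$ at the left. For $2$-boxes $x,y$ let $x\cdot y$ be the vertical composition with $y$ stacked on top of $x$, and $x\circ y$ the horizontal composition with $x$ to the left of $y$, the two right points of $x$ being joined to the two left points of $y$. Let $1$ be the $2$-box consisting of two vertical strings, and $1_h$ the one in which the two bottom points are joined and the two top points are joined. Let $\mathcal F:P_{2,\pm}\to P_{2,\mp}$ be the one-click rotation, so that $\mathcal F(x)$ is $x$ drawn with $\star$ at the top and $\mathcal F^2(x)$ is $x$ drawn with $\star$ at the right. Let $\sigma\in\mathbb C$. An element $R\in P_{2,+}$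 is called a quadratic $\sigma$-braiding if there are $R^{-1}\in P_{2,+}$ and $a\in\mathbb C\setminus\{0\}$ such that 1. (bi-invertibility) $R\cdot R^{-1}=1$ and $R\circ\mathcal F^2(R^{-1})=1_h$; 2. (twist) joining the two right points of $R$ by a string gives $a$ times a single vertical string in $P_{1,+}$, and joining the two right points of $\mathcal F(R)$ by a string gives $\sigma a^{-1}$ times a single vertical string in $P_{1,-}$; 3. (rotation) $R-\sigma^2\mathcal F^2(R)\in TL_{2,+}$; 4. ($\sigma$-braid relation) in $P_{3,+}$, writing $x_{(1)}$ for the box $x$ placed on the left two of three vertical strings, $x_{(2)}$ for the box $x$ placed on the right two, and stacking from bottom to top, $$\sigma\, R_{(1)}\,\mathcal F(R^{-1})_{(2)}\,R_{(1)}=\sigma^2\,\mathcal F(R^{-1})_{(2)}\,R_{(1)}\,\mathcal F(R^{-1})_{(2)};$$ 5. (quadratic relation) $R\cdot R\in TL_{2,+}+\mathbb C R$. Theorem. If $R\in P_{2,+}$ is a quadratic $\sigma$-braiding, then the planar subalgebra $Q_\bullet$ of $P_\bullet$ generated by $R$ is evaluable: every closed diagram in it, that is, every element of $Q_{0,+}$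 and of $Q_{0,-}$, is a scalar multiple of the empty diagram. -/

import Mathlib

/-!
Shaded planar algebras over `ℂ`, and quadratic `σ`-braidings.

A planar tangle is presented in generic rectangular position, as a stack of horizontal layers read
from bottom to top.  Every layer consists of vertical strands together with exactly one local
maximum, one local minimum, or one input disc.  Input discs are upright: the marked boundary
interval (the star) faces left, and all the boundary points of the disc are on its top edge, so
that reading them from left to right is reading them clockwise from the star.  The output disc is
treated in the same way: no boundary points at the bottom, all of them at the top, star at the left.
Two such presentations give isotopic tangles exactly when they are related by the moves
`Move` below (exchange of heights, straightening of a zigzag, full turn of an input disc).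

Boxes are indexed by a number `k`, for `2 * k` boundary points, and by the shading `s` of
the region that touches the star: `false` for unshaded (the space `P_{k,+}`), `true` for shaded
(the space `P_{k,-}`).
-/

universe u

namespace Planar

/-- The non-trivial part of a layer: a local minimum, a local maximum, or an upright disc with
`2 * k` boundary points and star region of shading `s`, labelled by `x`. -/
inductive Piece (L : ℕ → Bool → Type u) : Type u
  | cup : Piece L
  | cap : Piece L
  | box (k : ℕ) (s : Bool) (x : L k s) : Piece L

namespace Piece

variable {L : ℕ → Bool → Type u}

/-- Number of strands at the bottom of a piece. -/
def dn : Piece L → ℕ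
  | cup => 0
  | cap => 2
  | box _ _ _ => 0

/-- Number of strands at the top of a piece. -/
def up : Piece L → ℕ
  | cup => 2
  | cap => 0
  | box k _ _ => 2 * k

/-- The shading at the star of a disc must be the shading `t` of the region it is put into. -/
def Fits (t : Bool) : Piece L → Prop
  | cup => True
  | cap => True
  | box _ s _ => s = t

/-- The label of the piece, if there is one, lies in the given family of sets. -/
def LabelIn (S : ∀ k s, Set (L k s)) : Piece L → Prop
  | cup => True
  | cap => True
  | box k s x => x ∈ S k s

/-- The piece is not a disc. -/
def IsString : Piece L → Prop
  | cup => True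
  | cap => True
  | box _ _ _ => False

end Piece

/-- A layer: a piece with exactly `pos` vertical strands to its left (and any number of vertical
strands to its right). -/
structure Layer (L : ℕ → Bool → Type u) : Type u where
  pos : ℕ
  piece : Piece L

/-- A stack of layers, the lowest layer first. -/
abbrev Word (L : ℕ → Bool → Type u) : Type u := List (Layer L)

section words

variable {L : ℕ → Bool → Type u}

/-- Local minimum creating the strands number `i` and `i + 1` (strands are counted from `0`). -/
def cup (i : ℕ) : Layer L := ⟨i, .cup⟩

/-- Local maximum joining the strands number `i` and `i + 1`. -/
def cap (i : ℕ) : Layer L := ⟨i, .cap⟩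

/-- Input disc labelled by `x`, with `i` strands to its left. -/
def box (i : ℕ) {k : ℕ} {s : Bool} (x : L k s) : Layer L := ⟨i, .box k s x⟩

/-- Shading of the region with `i` strands to its left, if the leftmost region has
shading `s`. -/
def shadeAt (s : Bool) (i : ℕ) : Bool := if Even i then s else !s

/-- `IsTangle s m w n`: with leftmost region of shading `s`, the word `w` is a (shaded, labelled)
rectangular tangle with `m` strands at the bottom and `n` strands at the top. -/
def IsTangle (s : Bool) : ℕ → Word L → ℕ → Prop
  | m, [], n => m = n
  | m, l :: w, n =>
      l.pos + l.piece.dn ≤ m ∧ l.piece.Fits (shadeAt s l.pos) ∧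
        IsTangle s (m - l.piece.dn + l.piece.up) w n

/-- Put `i` vertical strands to the left of a rectangular tangle. -/
def shift (i : ℕ) (w : Word L) : Word L := w.map fun l => ⟨i + l.pos, l.piece⟩

/-- A labelled disc followed by a full turn: the strands leave the disc at the top, turn right, pass
under the disc and leave at its left.  The word is
`cup i, …, cup (i + 2k - 1), box (i + 2k) x, cap (i + 4k - 1), …, cap (i + 2k)`. -/
def fullTurn (i : ℕ) {k : ℕ} {s : Bool} (x : L k s) : Word L :=
  ((List.range (2 * k)).map fun j => cup (i + j)) ++
    box (i + 2 * k) x :: (List.range (2 * k)).reverse.map fun j => cap (i + 2 * k + j)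

/-- The elementary planar isotopies between rectangular tangles. -/
inductive Move : Word L → Word L → Prop
  /-- Two pieces in consecutive layers, `g` to the right of `f` and separated from it by `c`
  strands, exchange their heights. -/
  | exchange (u v : Word L) (f g : Piece L) (a c : ℕ) :
      Move (u ++ [⟨a, f⟩, ⟨a + f.up + c, g⟩] ++ v) (u ++ [⟨a + f.dn + c, g⟩, ⟨a, f⟩] ++ v)
  /-- A zigzag of one shape is straightened. -/
  | zigzag_left (u v : Word L) (i : ℕ) : Move (u ++ [cup i, cap (i + 1)] ++ v) (u ++ v)
  /-- A zigzag of the other shape is straightened. -/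
  | zigzag_right (u v : Word L) (i : ℕ) : Move (u ++ [cup (i + 1), cap i] ++ v) (u ++ v)
  /-- A disc makes a full turn. -/
  | turn (u v : Word L) (i : ℕ) {k : ℕ} {s : Bool} (x : L k s) :
      Move (u ++ [box i x] ++ v) (u ++ fullTurn i x ++ v)

end words

/-- A (shaded) planar algebra over `ℂ`: vector spaces `Box k s` and an action `Z` of the planar
tangles whose input discs are labelled by elements of these spaces. -/
structure PlanarAlgebra where
  Box : ℕ → Bool → Type u
  [addCommGroup : ∀ k s, AddCommGroup (Box k s)]
  [module : ∀ k s, Module ℂ (Box k s)]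
  /-- The value of a labelled tangle. -/
  Z : ∀ (k : ℕ) (s : Bool) (w : Word Box), IsTangle s 0 w (2 * k) → Box k s
  /-- The value depends on the labelled tangle only up to planar isotopy. -/
  Z_isotopy : ∀ (k : ℕ) (s : Bool) (w w' : Word Box) (h : IsTangle s 0 w (2 * k))
    (h' : IsTangle s 0 w' (2 * k)), Move w w' → Z k s w h = Z k s w' h'
  /-- The value is additive in every label. -/
  Z_add : ∀ (k : ℕ) (s : Bool) (u v : Word Box) (i j : ℕ) (t : Bool) (x y : Box j t)
    (h : IsTangle s 0 (u ++ [box i (x + y)] ++ v) (2 * k))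
    (hx : IsTangle s 0 (u ++ [box i x] ++ v) (2 * k))
    (hy : IsTangle s 0 (u ++ [box i y] ++ v) (2 * k)), Z k s _ h = Z k s _ hx + Z k s _ hy
  /-- The value is homogeneous in every label. -/
  Z_smul : ∀ (k : ℕ) (s : Bool) (u v : Word Box) (i j : ℕ) (t : Bool) (c : ℂ) (x : Box j t)
    (h : IsTangle s 0 (u ++ [box i (c • x)] ++ v) (2 * k))
    (hx : IsTangle s 0 (u ++ [box i x] ++ v) (2 * k)), Z k s _ h = c • Z k s _ hx
  /-- The identity tangle acts as the identity. -/
  Z_box : ∀ (k : ℕ) (s : Bool) (x : Box k s) (h : IsTangle s 0 [box 0 x] (2 * k)),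
    Z k s _ h = x
  /-- Compatibility with composition: an input disc labelled by the value of a tangle may be
  replaced by that tangle. -/
  Z_comp : ∀ (k : ℕ) (s : Bool) (u v : Word Box) (i j : ℕ) (t : Bool) (w : Word Box)
    (hw : IsTangle t 0 w (2 * j))
    (h : IsTangle s 0 (u ++ [box i (Z j t w hw)] ++ v) (2 * k))
    (h' : IsTangle s 0 (u ++ shift i w ++ v) (2 * k)), Z k s _ h = Z k s _ h'

namespace PlanarAlgebra

attribute [instance] PlanarAlgebra.addCommGroup PlanarAlgebra.module

/-- The planar algebra has modulus `δ`: a contractible closed loop, of either shading, may be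
removed at the price of a factor `δ`. -/
def HasModulus (A : PlanarAlgebra.{u}) (δ : ℂ) : Prop :=
  ∀ (k : ℕ) (s : Bool) (u v : Word A.Box) (i : ℕ)
    (h : IsTangle s 0 (u ++ [cup i, cap i] ++ v) (2 * k))
    (h' : IsTangle s 0 (u ++ v) (2 * k)), A.Z k s _ h = δ • A.Z k s _ h'

/-- The empty closed diagram in a region of shading `s`. -/
def emptyDiagram (A : PlanarAlgebra.{u}) (s : Bool) : A.Box 0 s := A.Z 0 s [] rfl

/-- The Temperley-Lieb subspace: the span of the tangles without input discs. -/
def temperleyLieb (A : PlanarAlgebra.{u}) (k : ℕ) (s : Bool) : Submodule ℂ (A.Box k s) :=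
  Submodule.span ℂ
    {x | ∃ (w : Word A.Box) (h : IsTangle s 0 w (2 * k)),
      (∀ l ∈ w, l.piece.IsString) ∧ A.Z k s w h = x}

/-- A planar subalgebra: a family of subspaces closed under the action of all planar tangles. -/
structure PlanarSubalgebra (A : PlanarAlgebra.{u}) where
  carrier : ∀ k s, Submodule ℂ (A.Box k s)
  Z_mem : ∀ (k : ℕ) (s : Bool) (w : Word A.Box) (h : IsTangle s 0 w (2 * k)),
    (∀ l ∈ w, l.piece.LabelIn fun j t => (carrier j t : Set (A.Box j t))) →
      A.Z k s w h ∈ carrier k s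

/-- The planar subalgebra generated by an element: the intersection of all planar subalgebras that
contain it. -/
def generatedBy (A : PlanarAlgebra.{u}) {k₀ : ℕ} {s₀ : Bool} (R : A.Box k₀ s₀) :
    A.PlanarSubalgebra where
  carrier k s := ⨅ (Q : A.PlanarSubalgebra) (_ : R ∈ Q.carrier k₀ s₀), Q.carrier k s
  Z_mem := by
    intro k s w h hw
    simp only [Submodule.mem_iInf]
    intro Q hQ
    refine Q.Z_mem k s w h fun l hl => ?_
    have hl' := hw l hl
    rcases l with ⟨i, p⟩
    cases p with
    | cup => trivial
    | cap => trivial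
    | box j t x =>
      simp only [Piece.LabelIn, SetLike.mem_coe, Submodule.mem_iInf] at hl' ⊢
      exact hl' Q hQ

/-- A planar subalgebra is evaluable if every closed diagram in it, in an unshaded or in a shaded
region, is equal to a scalar multiple of the empty diagram. -/
def PlanarSubalgebra.Evaluable {A : PlanarAlgebra.{u}} (Q : A.PlanarSubalgebra) : Prop :=
  ∀ s : Bool, ∀ x ∈ Q.carrier 0 s, ∃ c : ℂ, x = c • A.emptyDiagram s

section twoBoxes

variable {L : ℕ → Bool → Type u}

/-- A `2`-box drawn as a rectangle on the strands number `i` and `i + 1`, with two strands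
at the bottom, two at the top, and the star at the left. -/
def rect (i : ℕ) {s : Bool} (x : L 2 s) : Word L := [box i x, cap (i + 3), cap (i + 2)]

/-- `n` nested local minima: bends the bottom boundary points of a rectangular tangle with `n`
strands at the bottom around its right side to the top. -/
def bend (n : ℕ) : Word L := (List.range n).map cup

end twoBoxes

variable (A : PlanarAlgebra.{u})

/-- The one-click rotation `P_{2,±} → P_{2,∓}`: the last boundary point becomes the first one. -/
def rot {s : Bool} (x : A.Box 2 s) : A.Box 2 (!s) :=
  A.Z 2 (!s) [cup 0, box 1 x, cap 4]
    (by simp [IsTangle, cup, cap, box, Piece.dn, Piece.up, Piece.Fits, shadeAt])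

/-- Rotation of a `2`-box by two clicks, that is, by half a turn. -/
def rotTwo (x : A.Box 2 false) : A.Box 2 false := A.rot (A.rot x)

/-- The identity `1` of `P_{2,+}` (two vertical strands). -/
def one₂ : A.Box 2 false :=
  A.Z 2 false (bend 2) (by simp [IsTangle, bend, List.range_succ, cup, Piece.dn, Piece.up, Piece.Fits])

/-- The horizontal identity: one strand joins the two points at the bottom, one strand joins
the two points at the top. -/
def hone₂ : A.Box 2 false :=
  A.Z 2 false (bend 2 ++ [cap 0, cup 0])
    (by simp [IsTangle, bend, List.range_succ, cup, cap, Piece.dn, Piece.up, Piece.Fits])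

/-- One vertical strand. -/
def strand (s : Bool) : A.Box 1 s :=
  A.Z 1 s (bend 1) (by simp [IsTangle, bend, cup, Piece.dn, Piece.up, Piece.Fits])

/-- `y` stacked on top of `x`. -/
def stack (x y : A.Box 2 false) : A.Box 2 false :=
  A.Z 2 false (bend 2 ++ rect 0 x ++ rect 0 y)
    (by simp [IsTangle, bend, rect, List.range_succ, cup, cap, box, Piece.dn, Piece.up,
      Piece.Fits, shadeAt])

/-- `x` and `y` side by side, `x` to the left, the right points of `x` joined to the left
points of `y`. -/
def beside (x y : A.Box 2 false) : A.Box 2 false :=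
  A.Z 2 false (bend 2 ++ [cup 1] ++ rect 0 x ++ rect 2 y ++ [cap 1])
    (by simp [IsTangle, bend, rect, List.range_succ, cup, cap, box, Piece.dn, Piece.up,
      Piece.Fits, shadeAt])

/-- The two points at the right of `x` are joined by a strand. -/
def capRight {s : Bool} (x : A.Box 2 s) : A.Box 1 s :=
  A.Z 1 s (bend 1 ++ [cup 1] ++ rect 0 x ++ [cap 1])
    (by simp [IsTangle, bend, rect, cup, cap, box, Piece.dn, Piece.up,
      Piece.Fits, shadeAt])

/-- Three `2`-boxes on three strands: `x` on the two left strands, above it `y` on the two right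
strands, above it `z` on the two left strands. -/
def zigLeft (x : A.Box 2 false) (y : A.Box 2 true) (z : A.Box 2 false) : A.Box 3 false :=
  A.Z 3 false (bend 3 ++ rect 0 x ++ rect 1 y ++ rect 0 z)
    (by simp [IsTangle, bend, rect, List.range_succ, cup, cap, box, Piece.dn, Piece.up,
      Piece.Fits, shadeAt])

/-- Three `2`-boxes on three strands: `x` on the two right strands, above it `y` on the two left
strands, above it `z` on the two right strands. -/
def zigRight (x : A.Box 2 true) (y : A.Box 2 false) (z : A.Box 2 true) : A.Box 3 false :=
  A.Z 3 false (bend 3 ++ rect 1 x ++ rect 0 y ++ rect 1 z)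
    (by simp [IsTangle, bend, rect, List.range_succ, cup, cap, box, Piece.dn, Piece.up,
      Piece.Fits, shadeAt])

/-- The `2`-box `R`, with inverse `R'` and twist parameter `a`, is a quadratic `σ`-braiding.
Since the star of a box in `rect` is at the left, `rot x` is `x` drawn with its star
at the top, and `rotTwo x` is `x` drawn with its star at the right. -/
structure IsQuadraticBraidingWith (σ : ℂ) (R R' : A.Box 2 false) (a : ℂ) : Prop where
  /-- bi-invertibility, vertically -/
  stack_inv : A.stack R R' = A.one₂
  /-- bi-invertibility, horizontally -/
  beside_inv : A.beside R (A.rotTwo R') = A.hone₂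
  /-- the twist parameter is not zero -/
  a_ne_zero : a ≠ 0
  /-- twist relation, star at the left -/
  twist_left : A.capRight R = a • A.strand false
  /-- twist relation, star at the top -/
  twist_top : A.capRight (A.rot R) = (σ * a⁻¹) • A.strand true
  /-- rotation relation -/
  rotation : R - σ ^ 2 • A.rotTwo R ∈ A.temperleyLieb 2 false
  /-- `σ`-braid relation -/
  braid : σ • A.zigLeft R (A.rot R') R = σ ^ 2 • A.zigRight (A.rot R') R (A.rot R')
  /-- quadratic relation -/
  quadratic : A.stack R R ∈ A.temperleyLieb 2 false ⊔ Submodule.span ℂ {R}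

/-- `R` is a quadratic `σ`-braiding. -/
def IsQuadraticBraiding (σ : ℂ) (R : A.Box 2 false) : Prop :=
  ∃ (R' : A.Box 2 false) (a : ℂ), A.IsQuadraticBraidingWith σ R R' a

end PlanarAlgebra

end Planar

/-!
The idea is to exhibit, for every number `k` of pairs of boundary points, an explicit subspace
`standard T s k` of the planar algebra which is stable under all local minima, local maxima and
crossings, contains `R`, and consists of the multiples of the empty diagram for `k = 0`.

Every diagram is a stack of layers, so a diagram without strands at the bottom is obtained by
applying to the empty diagram the operators `cupAt i`, `capAt i` and `crossing T i`; here a crossing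
is `R` or its quarter turn, according to the shading to its left.  The standard subspace is spanned
by the diagrams which are built from the empty one by adding arcs: an arc is a local minimum whose
left end is pulled to the left across some of the older strands, that is, the operator
`crossing i ∘ crossing (i + 1) ∘ ⋯ ∘ crossing (i + d - 1) ∘ cupAt (i + d)`.  Stability is proved by
induction on the number of arcs (`SkeinRelations.stable`).  It needs only relations modulo simpler
diagrams (`SkeinRelations`): a bigon and a kink can be removed, a crossing can be pushed around a
local maximum or minimum, and one side of a triangle move is a combination of the other side and of
diagrams with fewer crossings.  With the stability at hand, `boxAt_mem_standard` shows that the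
standard subspaces form a planar subalgebra (`SkeinRelations.subalgebra`).

For the zero crossing all relations hold trivially, and the result says that the Temperley-Lieb
elements are spanned by the evident ones; in particular `P_{2,+}` has the Temperley-Lieb subspace
spanned by `1` and `1_h`.  So the quadratic relation reads `R · R = α + β 1_h + c R`.  If `σ = 0` or
`α = 0`, then `R` is itself a Temperley-Lieb element.  Otherwise `R⁻¹` and all rotations of `R` and of
`R⁻¹` are combinations of `R` (or its quarter turn) and of Temperley-Lieb elements, where `R` has a
non-zero coefficient.  The relations for unshaded regions are then those of the definition, and those
for shaded regions follow by turning them: horizontal composition becomes vertical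
(`rectAt_rot_beside`), and the braid relation is turned by one click (`rectAt_braid_rot`).
-/

namespace Planar

/-! ### Tangles as words -/

section tangles

variable {L : ℕ → Bool → Type u}

theorem shadeAt_shadeAt (s : Bool) (i j : ℕ) : shadeAt (shadeAt s i) j = shadeAt s (i + j) := by
  by_cases hi : Even i <;> by_cases hj : Even j <;> simp [shadeAt, hi, hj, Nat.even_add]

theorem shadeAt_add_two (s : Bool) (i : ℕ) : shadeAt s (i + 2) = shadeAt s i := by
  simp [shadeAt, Nat.even_add]

theorem shadeAt_succ (s : Bool) (i : ℕ) : shadeAt s (i + 1) = !shadeAt s i := by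
  by_cases hi : Even i <;> simp [shadeAt, hi, Nat.even_add_one]

theorem isTangle_append {s : Bool} {u v : Word L} {m n : ℕ} :
    IsTangle s m (u ++ v) n ↔ ∃ p, IsTangle s m u p ∧ IsTangle s p v n := by
  induction u generalizing m with
  | nil => simp [IsTangle]
  | cons l u ih => simp [IsTangle, ih, and_assoc]

theorem IsTangle.eq_of_eq {s : Bool} {w : Word L} {m n n' : ℕ} (h : IsTangle s m w n)
    (h' : IsTangle s m w n') : n = n' := by
  induction w generalizing m with
  | nil => exact h.symm.trans h'
  | cons l w ih => exact ih h.2.2 h'.2.2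

theorem isTangle_box_cons {s : Bool} {k n : ℕ} {x : L k s} {w : Word L} :
    IsTangle s 0 (box 0 x :: w) n ↔ IsTangle s (2 * k) w n := by
  simp [IsTangle, box, Piece.dn, Piece.up, Piece.Fits, shadeAt]

theorem shift_zero (w : Word L) : shift 0 w = w := by simp [shift]

theorem isTangle_shift {s : Bool} {w : Word L} {m n : ℕ} (i : ℕ)
    (h : IsTangle (shadeAt s i) m w n) (c : ℕ) :
    IsTangle s (i + m + c) (shift i w) (i + n + c) := by
  induction w generalizing m with
  | nil => simp only [IsTangle] at h; subst h; rfl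
  | cons l w ih =>
    obtain ⟨h₁, h₂, h₃⟩ := h
    refine ⟨by simp only; omega, ?_, ?_⟩
    · simpa only [shadeAt_shadeAt] using h₂
    · have := ih h₃
      have e : i + (m - l.piece.dn + l.piece.up) + c = i + m + c - l.piece.dn + l.piece.up := by
        omega
      rwa [e] at this

end tangles

namespace PlanarAlgebra

variable {A : PlanarAlgebra.{u}} {s t : Bool} {j k k' k'' : ℕ}

/-! ### The operators of rectangular tangles -/

theorem Z_congr {w w' : Word A.Box} (e : w = w') (h : IsTangle s 0 w (2 * k))
    (h' : IsTangle s 0 w' (2 * k)) : A.Z k s w h = A.Z k s w' h' := by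
  subst e; rfl

open Classical in
/-- The linear map given by a rectangular tangle with `2 * k` strands at the bottom and `2 * k'`
strands at the top; it is `0` if the word is not such a tangle. -/
noncomputable def act (A : PlanarAlgebra.{u}) (s : Bool) (k k' : ℕ) (w : Word A.Box) :
    A.Box k s →ₗ[ℂ] A.Box k' s where
  toFun x := if h : IsTangle s (2 * k) w (2 * k') then
    A.Z k' s (box 0 x :: w) (isTangle_box_cons.2 h) else 0
  map_add' x y := by
    split_ifs with h
    · exact A.Z_add k' s [] w 0 k s x y _ _ _
    · simp
  map_smul' c x := by
    split_ifs with h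
    · exact A.Z_smul k' s [] w 0 k s c x _ _
    · simp

theorem act_apply {w : Word A.Box} (h : IsTangle s (2 * k) w (2 * k')) (x : A.Box k s) :
    act A s k k' w x = A.Z k' s (box 0 x :: w) (isTangle_box_cons.2 h) := dif_pos h

theorem act_of_not {w : Word A.Box} (h : ¬ IsTangle s (2 * k) w (2 * k')) :
    act A s k k' w = 0 := by
  ext x; exact dif_neg h

theorem act_nil (x : A.Box k s) : act A s k k [] x = x := by
  rw [act_apply (w := []) rfl]; exact A.Z_box k s x _

theorem act_emptyDiagram {w : Word A.Box} (h : IsTangle s 0 w (2 * k)) :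
    act A s 0 k w (A.emptyDiagram s) = A.Z k s w h := by
  rw [act_apply (k := 0) h]
  exact A.Z_comp k s [] w 0 0 s [] rfl _ h

theorem act_act {w : Word A.Box} (hw : IsTangle s (2 * k) w (2 * k')) (w' : Word A.Box)
    (x : A.Box k s) : act A s k' k'' w' (act A s k k' w x) = act A s k k'' (w ++ w') x := by
  by_cases h : IsTangle s (2 * k') w' (2 * k'')
  · have h₁ : IsTangle s (2 * k) (w ++ w') (2 * k'') := isTangle_append.2 ⟨_, hw, h⟩
    rw [act_apply h, act_apply hw, act_apply h₁]
    have e : shift 0 (box 0 x :: w) ++ w' = box 0 x :: (w ++ w') := by rw [shift_zero]; rfl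
    refine (A.Z_comp k'' s [] w' 0 k' s (box 0 x :: w) _ (isTangle_box_cons.2 h) ?_).trans ?_
    · exact e ▸ isTangle_box_cons.2 h₁
    · exact Z_congr e _ _
  · rw [act_of_not h, act_of_not (w := w ++ w') ?_, LinearMap.zero_apply, LinearMap.zero_apply]
    rintro h₁
    obtain ⟨p, hp, hp'⟩ := isTangle_append.1 h₁
    rw [hp.eq_of_eq hw] at hp'
    exact h hp'

theorem act_eq_of_move {w w' : Word A.Box} (hm : Move w w') (h : IsTangle s (2 * k) w (2 * k'))
    (h' : IsTangle s (2 * k) w' (2 * k')) : act A s k k' w = act A s k k' w' := by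
  ext x
  rw [act_apply h, act_apply h']
  refine A.Z_isotopy _ _ _ _ _ _ ?_
  cases hm with
  | exchange u v f g a c => exact .exchange (box 0 x :: u) v f g a c
  | zigzag_left u v i => exact .zigzag_left (box 0 x :: u) v i
  | zigzag_right u v i => exact .zigzag_right (box 0 x :: u) v i
  | turn u v i y => exact .turn (box 0 x :: u) v i y

/-- Two layers acting one after the other; the composition rule needs no validity, since an
invalid first layer gives `0` on both sides. -/
theorem act_singleton_act_singleton (l l' : Layer A.Box)
    (hk : l.pos + l.piece.dn ≤ 2 * k → 2 * k - l.piece.dn + l.piece.up = 2 * k')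
    (x : A.Box k s) :
    act A s k' k'' [l'] (act A s k k' [l] x) = act A s k k'' [l, l'] x := by
  by_cases h : l.pos + l.piece.dn ≤ 2 * k ∧ l.piece.Fits (shadeAt s l.pos)
  · exact act_act (w := [l]) ⟨h.1, h.2, hk h.1⟩ [l'] x
  · rw [act_of_not (w := [l]) fun h' => h ⟨h'.1, h'.2.1⟩,
      act_of_not (w := [l, l']) fun h' => h ⟨h'.1, h'.2.1⟩]
    simp

theorem shadeAt_add_up (f : Piece A.Box) (i c : ℕ) :
    shadeAt s (i + f.up + c) = shadeAt s (i + f.dn + c) := by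
  cases f <;> simp [shadeAt, Piece.up, Piece.dn, Nat.even_add]

theorem act_exchange (f g : Piece A.Box) (a c : ℕ) {p q : ℕ} (hp : p = a + f.up + c)
    (hq : q = a + f.dn + c) :
    act A s k k' [⟨a, f⟩, ⟨p, g⟩] = act A s k k' [⟨q, g⟩, ⟨a, f⟩] := by
  subst hp hq
  have key : IsTangle s (2 * k) [⟨a, f⟩, ⟨a + f.up + c, g⟩] (2 * k') ↔
      IsTangle s (2 * k) [⟨a + f.dn + c, g⟩, ⟨a, f⟩] (2 * k') := by
    simp only [IsTangle, shadeAt_add_up f a c]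
    constructor
    · rintro ⟨h₁, h₂, h₃, h₄, h₅⟩
      exact ⟨by omega, h₄, by omega, h₂, by omega⟩
    · rintro ⟨h₁, h₂, h₃, h₄, h₅⟩
      exact ⟨by omega, h₄, by omega, h₂, by omega⟩
  by_cases h : IsTangle s (2 * k) [⟨a, f⟩, ⟨a + f.up + c, g⟩] (2 * k')
  · exact act_eq_of_move (.exchange [] [] f g a c) h (key.1 h)
  · rw [act_of_not h, act_of_not (fun h' => h (key.2 h'))]

/-- Heights of two pieces in consecutive layers are exchanged. -/
theorem act_act_exchange (f g : Piece A.Box) {i p q k₁ k₂ : ℕ} (h : i + f.dn ≤ q)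
    (hp : p + f.dn = q + f.up) (h₁ : 2 * k + f.up = 2 * k₁ + f.dn)
    (h₂ : 2 * k + g.up = 2 * k₂ + g.dn) (x : A.Box k s) :
    act A s k₁ k' [⟨p, g⟩] (act A s k k₁ [⟨i, f⟩] x) =
      act A s k₂ k' [⟨i, f⟩] (act A s k k₂ [⟨q, g⟩] x) := by
  rw [act_singleton_act_singleton _ _ (by simp only; omega),
    act_singleton_act_singleton _ _ (by simp only; omega),
    act_exchange f g i (q - i - f.dn) (q := q) (by omega) (by omega)]

/-- A local minimum is put on top, at the strands `i` and `i + 1`. -/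
noncomputable def cupAt (i : ℕ) : A.Box k s →ₗ[ℂ] A.Box (k + 1) s := act A s k (k + 1) [cup i]

/-- A local maximum is put on top, joining the strands `i` and `i + 1`. -/
noncomputable def capAt (i : ℕ) : A.Box (k + 1) s →ₗ[ℂ] A.Box k s := act A s (k + 1) k [cap i]

/-- An upright disc labelled by `y` is put on top, with `i` strands to its left. -/
noncomputable def boxAt (i : ℕ) (y : A.Box j t) : A.Box k s →ₗ[ℂ] A.Box (k + j) s :=
  act A s k (k + j) [box i y]

/-- The `2`-box `y`, drawn as a rectangle, is put on top of the strands `i` and `i + 1`. -/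
noncomputable def rectAt (i : ℕ) (y : A.Box 2 t) : A.Box k s →ₗ[ℂ] A.Box k s :=
  capAt (i + 2) ∘ₗ capAt (i + 3) ∘ₗ boxAt i y

theorem rectAt_apply (i : ℕ) (y : A.Box 2 t) (x : A.Box k s) :
    rectAt i y x = capAt (i + 2) (capAt (i + 3) (boxAt i y x)) := rfl

theorem boxAt_of_shade_ne {i : ℕ} (h : t ≠ shadeAt s i) (y : A.Box j t) :
    (boxAt i y : A.Box k s →ₗ[ℂ] A.Box (k + j) s) = 0 :=
  act_of_not fun h' => h h'.2.1

theorem isTangle_boxAt {i : ℕ} (hi : i ≤ 2 * k) (y : A.Box j (shadeAt s i)) :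
    IsTangle s (2 * k) [box i y] (2 * (k + j)) :=
  ⟨hi, rfl, by simp only [IsTangle, box, Piece.dn, Piece.up]; omega⟩

theorem act_cup_cons {i : ℕ} (hi : i ≤ 2 * k) (w : Word A.Box) (x : A.Box k s) :
    act A s k k' (cup i :: w) x = act A s (k + 1) k' w (cupAt i x) :=
  (act_act (w := [cup i]) (k' := k + 1) ⟨hi, trivial, rfl⟩ w x).symm

theorem act_cap_cons {i : ℕ} (hi : i ≤ 2 * k) (w : Word A.Box) (x : A.Box (k + 1) s) :
    act A s (k + 1) k' (cap i :: w) x = act A s k k' w (capAt i x) :=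
  (act_act (w := [cap i]) (k' := k) ⟨Nat.add_le_add_right hi 2, trivial,
    (show 2 * (k + 1) - 2 + 0 = 2 * k by omega)⟩ w x).symm

theorem act_box_cons {i : ℕ} (hi : i ≤ 2 * k) (ht : t = shadeAt s i) (y : A.Box j t)
    (w : Word A.Box) (x : A.Box k s) :
    act A s k k' (box i y :: w) x = act A s (k + j) k' w (boxAt i y x) := by
  subst ht
  exact (act_act (w := [box i y]) (isTangle_boxAt hi y) w x).symm

theorem act_rect_append {i : ℕ} (hi : i + 2 ≤ 2 * k) (ht : t = shadeAt s i) (y : A.Box 2 t)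
    (w : Word A.Box) (x : A.Box k s) :
    act A s k k' (box i y :: cap (i + 3) :: cap (i + 2) :: w) x =
      act A s k k' w (rectAt i y x) := by
  rw [act_box_cons (by omega) ht, act_cap_cons (by omega), act_cap_cons (by omega)]
  rfl

theorem boxAt_add (i : ℕ) (y z : A.Box j t) (x : A.Box k s) :
    boxAt i (y + z) x = boxAt i y x + boxAt i z x := by
  by_cases h : t = shadeAt s i ∧ i ≤ 2 * k
  · obtain ⟨rfl, hi⟩ := h
    simp only [boxAt]
    rw [act_apply (isTangle_boxAt hi _), act_apply (isTangle_boxAt hi _),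
      act_apply (isTangle_boxAt hi _)]
    exact A.Z_add _ s [box 0 x] [] i j _ y z _ _ _
  · have h' : ∀ y : A.Box j t, (boxAt i y : A.Box k s →ₗ[ℂ] A.Box (k + j) s) = 0 :=
      fun y => act_of_not fun h' => h ⟨h'.2.1, h'.1⟩
    simp [h']

theorem boxAt_smul (i : ℕ) (c : ℂ) (y : A.Box j t) (x : A.Box k s) :
    boxAt i (c • y) x = c • boxAt i y x := by
  by_cases h : t = shadeAt s i ∧ i ≤ 2 * k
  · obtain ⟨rfl, hi⟩ := h
    simp only [boxAt]
    rw [act_apply (isTangle_boxAt hi _), act_apply (isTangle_boxAt hi _)]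
    exact A.Z_smul _ s [box 0 x] [] i j _ c y _ _
  · have h' : ∀ y : A.Box j t, (boxAt i y : A.Box k s →ₗ[ℂ] A.Box (k + j) s) = 0 :=
      fun y => act_of_not fun h' => h ⟨h'.2.1, h'.1⟩
    simp [h']

theorem rectAt_add (i : ℕ) (y z : A.Box 2 t) (x : A.Box k s) :
    rectAt i (y + z) x = rectAt i y x + rectAt i z x := by
  simp [rectAt_apply, boxAt_add]

theorem rectAt_smul (i : ℕ) (c : ℂ) (y : A.Box 2 t) (x : A.Box k s) :
    rectAt i (c • y) x = c • rectAt i y x := by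
  simp [rectAt_apply, boxAt_smul]

/-! ### Isotopy relations between the operators -/

section isotopy

variable {i p : ℕ}

theorem cupAt_cupAt (h : i ≤ p) (x : A.Box k s) :
    cupAt (p + 2) (cupAt i x) = cupAt i (cupAt p x) := by
  exact act_act_exchange .cup .cup (by simp only [Piece.dn]; omega)
    rfl rfl rfl x

theorem capAt_cupAt (h : i ≤ p) (x : A.Box (k + 1) s) :
    capAt (p + 2) (cupAt i x) = cupAt i (capAt p x) := by
  exact act_act_exchange .cup .cap (by simp only [Piece.dn]; omega)
    rfl rfl rfl x

theorem cupAt_capAt (h : i ≤ p) (x : A.Box (k + 1) s) :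
    cupAt p (capAt i x) = capAt i (cupAt (p + 2) x) := by
  exact act_act_exchange (p := p) (q := p + 2) .cap .cup (by simp only [Piece.dn]; omega)
    rfl rfl rfl x

theorem capAt_capAt (h : i ≤ p) (x : A.Box (k + 2) s) :
    capAt p (capAt i x) = capAt i (capAt (p + 2) x) := by
  exact act_act_exchange (p := p) (q := p + 2) .cap .cap (by simp only [Piece.dn]; omega)
    rfl rfl rfl x

theorem boxAt_cupAt (h : i ≤ p) (y : A.Box 2 t) (x : A.Box k s) :
    boxAt (p + 2) y (cupAt i x) = cupAt i (boxAt p y x) := by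
  exact act_act_exchange .cup (.box 2 t y) (by simp only [Piece.dn]; omega)
    rfl rfl rfl x

theorem boxAt_capAt (h : i ≤ p) (y : A.Box 2 t) (x : A.Box (k + 1) s) :
    boxAt p y (capAt i x) = capAt i (boxAt (p + 2) y x) := by
  exact act_act_exchange (p := p) (q := p + 2) .cap (.box 2 t y) (by simp only [Piece.dn]; omega)
    rfl rfl rfl x

theorem cupAt_boxAt (h : i ≤ p) (y : A.Box 2 t) (x : A.Box k s) :
    cupAt (p + 4) (boxAt i y x) = boxAt i y (cupAt p x) := by
  exact act_act_exchange (.box 2 t y) .cup (by simp only [Piece.dn]; omega)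
    rfl rfl rfl x

theorem capAt_boxAt (h : i ≤ p) (y : A.Box 2 t) (x : A.Box (k + 1) s) :
    capAt (p + 4) (boxAt i y x) = boxAt i y (capAt p x) := by
  exact act_act_exchange (.box 2 t y) .cap (by simp only [Piece.dn]; omega)
    rfl rfl rfl x

theorem boxAt_boxAt {t' : Bool} (h : i ≤ p) (y : A.Box 2 t) (z : A.Box 2 t') (x : A.Box k s) :
    boxAt (p + 4) z (boxAt i y x) = boxAt i y (boxAt p z x) := by
  exact act_act_exchange (.box 2 t y) (.box 2 t' z) (by simp only [Piece.dn]; omega)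
    rfl rfl rfl x

theorem capAt_succ_cupAt (h : i + 1 ≤ 2 * k) (x : A.Box k s) :
    capAt (i + 1) (cupAt i x) = x := by
  simp only [cupAt, capAt]
  rw [act_singleton_act_singleton]
  · rw [act_eq_of_move (w := [cup i, cap (i + 1)]) (.zigzag_left [] [] i) _ rfl]
    · exact act_nil x
    · simp [IsTangle, cup, cap, Piece.dn, Piece.up, Piece.Fits]; omega
  · simp [cup, Piece.dn, Piece.up]; omega

theorem capAt_cupAt_succ (h : i + 1 ≤ 2 * k) (x : A.Box k s) :
    capAt i (cupAt (i + 1) x) = x := by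
  simp only [cupAt, capAt]
  rw [act_singleton_act_singleton]
  · rw [act_eq_of_move (w := [cup (i + 1), cap i]) (.zigzag_right [] [] i) _ rfl]
    · exact act_nil x
    · simp [IsTangle, cup, cap, Piece.dn, Piece.up, Piece.Fits]; omega
  · simp [cup, Piece.dn, Piece.up]; omega

theorem capAt_cupAt_self {δ : ℂ} (hδ : A.HasModulus δ) (h : i ≤ 2 * k) (x : A.Box k s) :
    capAt i (cupAt i x) = δ • x := by
  have h' : IsTangle (L := A.Box) s (2 * k) [cup i, cap i] (2 * k) := by
    simp [IsTangle, cup, cap, Piece.dn, Piece.up, Piece.Fits]; omega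
  simp only [cupAt, capAt]
  rw [act_singleton_act_singleton, act_apply h']
  · refine (hδ k s [box 0 x] [] i _ (isTangle_box_cons.2 rfl)).trans ?_
    exact congrArg _ (A.Z_box k s x _)
  · simp [cup, Piece.dn, Piece.up]; omega

theorem rectAt_cupAt_left (h : i ≤ p) (y : A.Box 2 t) (x : A.Box k s) :
    rectAt (p + 2) y (cupAt i x) = cupAt i (rectAt p y x) := by
  simp only [rectAt_apply]
  rw [boxAt_cupAt h, capAt_cupAt (p := p + 3) (by omega), capAt_cupAt (p := p + 2) (by omega)]

theorem rectAt_capAt_left (h : i ≤ p) (y : A.Box 2 t) (x : A.Box (k + 1) s) :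
    rectAt p y (capAt i x) = capAt i (rectAt (p + 2) y x) := by
  simp only [rectAt_apply]
  rw [boxAt_capAt h, capAt_capAt (i := i) (p := p + 3) (by omega),
    capAt_capAt (i := i) (p := p + 2) (by omega)]

theorem rectAt_cupAt_right (h : i + 2 ≤ p) (y : A.Box 2 t) (x : A.Box k s) :
    rectAt i y (cupAt p x) = cupAt p (rectAt i y x) := by
  simp only [rectAt_apply]
  rw [← cupAt_boxAt (by omega), cupAt_capAt (p := p) (by omega),
    cupAt_capAt (p := p + 2) (by omega)]

theorem rectAt_capAt_right (h : i + 2 ≤ p) (y : A.Box 2 t) (x : A.Box (k + 1) s) :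
    rectAt i y (capAt p x) = capAt p (rectAt i y x) := by
  simp only [rectAt_apply]
  rw [← capAt_boxAt (by omega), capAt_capAt (p := p) (by omega),
    capAt_capAt (p := p + 2) (by omega)]

theorem rectAt_comm {t' : Bool} (h : i + 2 ≤ p) (y : A.Box 2 t) (z : A.Box 2 t')
    (x : A.Box k s) : rectAt p z (rectAt i y x) = rectAt i y (rectAt p z x) := by
  simp only [rectAt_apply (i := i)]
  rw [rectAt_capAt_left (by omega), rectAt_capAt_left (by omega)]
  congr 2
  simp only [rectAt_apply]
  rw [boxAt_boxAt (by omega), capAt_boxAt (p := p + 3) (by omega),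
    capAt_boxAt (p := p + 2) (by omega)]

end isotopy

/-! ### Composition -/

section composition

variable {i p : ℕ}

/-- A disc labelled by the value of a tangle may be replaced by that tangle. -/
theorem boxAt_Z (hi : i ≤ 2 * k) (ht : t = shadeAt s i) {w : Word A.Box}
    (h : IsTangle t 0 w (2 * j)) (x : A.Box k s) :
    boxAt i (A.Z j t w h) x = act A s k (k + j) (shift i w) x := by
  subst ht
  have h₁ : IsTangle s (2 * k) (shift i w) (2 * (k + j)) := by
    have := isTangle_shift i h (2 * k - i)
    convert this using 1 <;> omega
  simp only [boxAt]
  rw [act_apply (isTangle_boxAt hi _), act_apply h₁]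
  exact (A.Z_comp (k + j) s [box 0 x] [] i j (shadeAt s i) w h _
    (isTangle_box_cons.2 (by simpa using h₁))).trans (Z_congr (by simp) _ _)

theorem boxAt_act (hi : i ≤ 2 * k) {w : Word A.Box}
    (h : IsTangle (shadeAt s i) (2 * k') w (2 * k'')) (y : A.Box k' (shadeAt s i))
    (x : A.Box k s) :
    boxAt i (act A (shadeAt s i) k' k'' w y) x =
      act A s (k + k') (k + k'') (shift i w) (boxAt i y x) := by
  rw [act_apply h, boxAt_Z hi rfl]
  exact act_box_cons hi rfl y (shift i w) x

theorem boxAt_emptyDiagram (hi : i ≤ 2 * k) (x : A.Box k s) :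
    boxAt i (A.emptyDiagram (shadeAt s i)) x = x :=
  (boxAt_Z (j := 0) hi rfl (w := []) rfl x).trans (act_nil x)

theorem boxAt_cupAt_label (hi : i ≤ 2 * k) (hp : p ≤ 2 * j) (y : A.Box j (shadeAt s i))
    (x : A.Box k s) : boxAt i (cupAt p y) x = cupAt (i + p) (boxAt i y x) :=
  boxAt_act hi (by simp [IsTangle, cup, Piece.dn, Piece.up, Piece.Fits]; omega) y x

theorem boxAt_capAt_label (hi : i ≤ 2 * k) (hp : p ≤ 2 * j) (y : A.Box (j + 1) (shadeAt s i))
    (x : A.Box k s) : boxAt i (capAt p y) x = capAt (i + p) (boxAt i y x) :=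
  boxAt_act hi (by simp [IsTangle, cap, Piece.dn, Piece.up, Piece.Fits]; omega) y x

theorem boxAt_boxAt_label (hi : i ≤ 2 * k) (hp : p ≤ 2 * j) {t : Bool}
    (ht : t = shadeAt s (i + p)) (z : A.Box 2 t) (y : A.Box j (shadeAt s i))
    (x : A.Box k s) : boxAt i (boxAt p z y) x = boxAt (i + p) z (boxAt i y x) :=
  boxAt_act hi (by
    simp [IsTangle, box, Piece.dn, Piece.up, Piece.Fits, shadeAt_shadeAt, ht]; omega) y x

theorem boxAt_rectAt_label (hi : i ≤ 2 * k) (hp : p + 2 ≤ 2 * j) {t : Bool}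
    (ht : t = shadeAt s (i + p)) (z : A.Box 2 t) (y : A.Box j (shadeAt s i))
    (x : A.Box k s) : boxAt i (rectAt p z y) x = rectAt (i + p) z (boxAt i y x) := by
  simp only [rectAt_apply]
  rw [boxAt_capAt_label hi (by omega), boxAt_capAt_label hi (by omega),
    boxAt_boxAt_label hi (by omega) ht]
  rfl

/-- An upright disc is a rectangle standing on two nested local minima. -/
theorem rectAt_cupAt_cupAt (hi : i ≤ 2 * k) (y : A.Box 2 t) (x : A.Box k s) :
    rectAt i y (cupAt (i + 1) (cupAt i x)) = boxAt i y x := by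
  rw [rectAt_apply, ← cupAt_boxAt (by omega), ← cupAt_boxAt (by omega),
    ← cupAt_capAt (i := i + 3) (p := i + 3) le_rfl, capAt_cupAt_succ (i := i + 3) (by omega),
    capAt_cupAt_succ (i := i + 2) (by omega)]

end composition

/-! ### Crossings and skein relations -/

/-- A linear map carries the span of a set into every subspace containing the image of the set. -/
theorem map_mem_of_mem_span {V W : Type*} [AddCommGroup V] [Module ℂ V] [AddCommGroup W]
    [Module ℂ W] {S : Set V} {x : V} (hx : x ∈ Submodule.span ℂ S) (f : V →ₗ[ℂ] W)
    {U : Submodule ℂ W} (h : ∀ y ∈ S, f y ∈ U) : f x ∈ U :=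
  (Submodule.span_le (p := U.comap f)).2 h hx

theorem mem_of_mem_span {V : Type*} [AddCommGroup V] [Module ℂ V] {S : Set V} {x : V}
    (hx : x ∈ Submodule.span ℂ S) {U : Submodule ℂ V} (h : ∀ y ∈ S, y ∈ U) : x ∈ U :=
  Submodule.span_le.2 h hx

/-- The crossing at the strands `i` and `i + 1`: the `2`-box `T false` or `T true`, according to
the shading of the region to its left. -/
noncomputable def crossing (T : ∀ t, A.Box 2 t) (i : ℕ) : A.Box k s →ₗ[ℂ] A.Box k s :=
  rectAt i (T (shadeAt s i))

/-- The skein relations of a crossing: a bigon, a kink, a rotated crossing below a local maximum or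
above a local minimum, and one side of a triangle move are expressed by simpler diagrams. -/
structure SkeinRelations (T : ∀ t, A.Box 2 t) : Prop where
  bigon : ∀ {s k i} (x : A.Box (k + 1) s), i ≤ 2 * k →
    crossing T i (crossing T i x) ∈
      Submodule.span ℂ {x, cupAt i (capAt i x), crossing T i x}
  cap_crossing : ∀ {s k i} (x : A.Box (k + 1) s), i ≤ 2 * k →
    capAt i (crossing T i x) ∈ Submodule.span ℂ {capAt i x}
  crossing_cup : ∀ {s k i} (x : A.Box k s), i ≤ 2 * k →
    crossing T i (cupAt i x) ∈ Submodule.span ℂ {cupAt i x}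
  kink : ∀ {s k i} (x : A.Box k s), i + 1 ≤ 2 * k →
    capAt (i + 1) (crossing T i (cupAt (i + 1) x)) ∈ Submodule.span ℂ {x}
  cap_crossing_succ : ∀ {s k i} (x : A.Box (k + 1) s), i + 1 ≤ 2 * k →
    capAt i (crossing T (i + 1) x) ∈
      Submodule.span ℂ {capAt (i + 1) (crossing T i x), capAt i x, capAt (i + 1) x}
  cap_succ_crossing : ∀ {s k i} (x : A.Box (k + 1) s), i + 1 ≤ 2 * k →
    capAt (i + 1) (crossing T i x) ∈
      Submodule.span ℂ {capAt i (crossing T (i + 1) x), capAt i x, capAt (i + 1) x}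
  crossing_succ_cup : ∀ {s k i} (x : A.Box k s), i + 1 ≤ 2 * k →
    crossing T (i + 1) (cupAt i x) ∈
      Submodule.span ℂ {crossing T i (cupAt (i + 1) x), cupAt i x, cupAt (i + 1) x}
  crossing_cup_succ : ∀ {s k i} (x : A.Box k s), i + 1 ≤ 2 * k →
    crossing T i (cupAt (i + 1) x) ∈
      Submodule.span ℂ {crossing T (i + 1) (cupAt i x), cupAt i x, cupAt (i + 1) x}
  triangle : ∀ {s k i} (x : A.Box (k + 1) s), i + 1 ≤ 2 * k →
    crossing T (i + 1) (crossing T i (crossing T (i + 1) x)) ∈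
      Submodule.span ℂ {
        crossing T i (crossing T (i + 1) (crossing T i x)),
        crossing T (i + 1) (crossing T i x),
        crossing T i (crossing T (i + 1) x),
        crossing T i (crossing T i x),
        crossing T i x,
        crossing T i (cupAt (i + 1) (capAt (i + 1) (crossing T i x))),
        crossing T (i + 1) (crossing T i (cupAt (i + 1) (capAt (i + 1) x))),
        cupAt (i + 1) (capAt (i + 1) (crossing T i (crossing T (i + 1) x))),
        cupAt (i + 1) (capAt (i + 1) (crossing T i (cupAt (i + 1) (capAt (i + 1) x)))),
        cupAt (i + 1) (capAt (i + 1) (crossing T i x)),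
        crossing T i (cupAt (i + 1) (capAt (i + 1) x)),
        crossing T i (crossing T (i + 1) (cupAt i (capAt i x))),
        crossing T i (cupAt (i + 1) (capAt (i + 1) (cupAt i (capAt i x)))),
        crossing T i (cupAt i (capAt i x))}

/-! ### Arcs -/

section commutation

variable (T : ∀ t, A.Box 2 t) {i p : ℕ}

theorem crossing_cupAt_left (h : i ≤ p) (x : A.Box k s) :
    crossing T (p + 2) (cupAt i x) = cupAt i (crossing T p x) := by
  simp only [crossing]; rw [shadeAt_add_two]; exact rectAt_cupAt_left h _ x

theorem crossing_capAt_left (h : i ≤ p) (x : A.Box (k + 1) s) :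
    crossing T p (capAt i x) = capAt i (crossing T (p + 2) x) := by
  simp only [crossing]; rw [shadeAt_add_two]; exact rectAt_capAt_left h _ x

theorem crossing_cupAt_right (h : i + 2 ≤ p) (x : A.Box k s) :
    crossing T i (cupAt p x) = cupAt p (crossing T i x) := rectAt_cupAt_right h _ x

theorem crossing_capAt_right (h : i + 2 ≤ p) (x : A.Box (k + 1) s) :
    crossing T i (capAt p x) = capAt p (crossing T i x) := rectAt_capAt_right h _ x

theorem crossing_comm (h : i + 2 ≤ p) (x : A.Box k s) :
    crossing T p (crossing T i x) = crossing T i (crossing T p x) := rectAt_comm h _ _ x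

/-- The strand `i + m` is moved to the position `i`, across `m` strands: the crossings at
`i + m - 1, …, i + 1, i`, one after the other. -/
noncomputable def slide : ℕ → ℕ → (A.Box k s →ₗ[ℂ] A.Box k s)
  | 0, _ => LinearMap.id
  | m + 1, i => crossing T i ∘ₗ slide m (i + 1)

/-- A new arc: a local minimum at the position `i + d`, whose left end is then moved to the
position `i`. -/
noncomputable def arc : ℕ → ℕ → (A.Box k s →ₗ[ℂ] A.Box (k + 1) s)
  | 0, i => cupAt i
  | d + 1, i => crossing T i ∘ₗ arc d (i + 1)

theorem slide_succ (m i : ℕ) (x : A.Box k s) :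
    slide T (m + 1) i x = crossing T i (slide T m (i + 1) x) := rfl

theorem arc_zero (i : ℕ) (x : A.Box k s) : arc T 0 i x = cupAt i x := rfl

theorem arc_succ (d i : ℕ) (x : A.Box k s) :
    arc T (d + 1) i x = crossing T i (arc T d (i + 1) x) := rfl

theorem slide_arc (m d i : ℕ) (x : A.Box k s) :
    slide T m i (arc T d (i + m) x) = arc T (m + d) i x := by
  induction m generalizing i with
  | zero => simp [slide]
  | succ m ih =>
    have := ih (i + 1)
    rw [slide_succ, Nat.succ_add, arc_succ, ← this, Nat.add_right_comm, Nat.add_assoc]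

theorem slide_cupAt_eq_arc (m i : ℕ) (x : A.Box k s) :
    slide T m i (cupAt (i + m) x) = arc T m i x := slide_arc T m 0 i x

theorem slide_cupAt {m : ℕ} (h : i + m + 1 ≤ p) (x : A.Box k s) :
    slide T m i (cupAt p x) = cupAt p (slide T m i x) := by
  induction m generalizing i with
  | zero => rfl
  | succ m ih =>
    rw [slide_succ, slide_succ, ih (by omega), crossing_cupAt_right T (by omega)]

theorem slide_capAt {m : ℕ} (h : i + m + 1 ≤ p) (x : A.Box (k + 1) s) :
    slide T m i (capAt p x) = capAt p (slide T m i x) := by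
  induction m generalizing i with
  | zero => rfl
  | succ m ih =>
    rw [slide_succ, slide_succ, ih (by omega), crossing_capAt_right T (by omega)]

theorem crossing_slide {m : ℕ} (h : i + m + 1 ≤ p) (x : A.Box k s) :
    crossing T p (slide T m i x) = slide T m i (crossing T p x) := by
  induction m generalizing i with
  | zero => rfl
  | succ m ih =>
    rw [slide_succ, slide_succ, crossing_comm T (by omega), ih (by omega)]

theorem crossing_arc_left {d : ℕ} (h : p + 2 ≤ i) (x : A.Box k s) :
    crossing T p (arc T d i x) = arc T d i (crossing T p x) := by
  induction d generalizing i with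
  | zero => exact crossing_cupAt_right T h x
  | succ d ih => rw [arc_succ, arc_succ, ← crossing_comm T h, ih (by omega)]

theorem crossing_arc_right {d : ℕ} (h : i + d ≤ p) (x : A.Box k s) :
    crossing T (p + 2) (arc T d i x) = arc T d i (crossing T p x) := by
  induction d generalizing i with
  | zero => exact crossing_cupAt_left T h x
  | succ d ih => rw [arc_succ, arc_succ, crossing_comm T (by omega), ih (by omega)]

theorem capAt_arc_left {d : ℕ} (h : p ≤ i) (x : A.Box (k + 1) s) :
    capAt p (arc T d (i + 2) x) = arc T d i (capAt p x) := by
  induction d generalizing i with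
  | zero => exact (cupAt_capAt h x).symm
  | succ d ih =>
    rw [arc_succ, arc_succ, ← crossing_capAt_left T h, ← ih (by omega)]

theorem capAt_arc_right {d : ℕ} (h : i + d ≤ p) (x : A.Box (k + 1) s) :
    capAt (p + 2) (arc T d i x) = arc T d i (capAt p x) := by
  induction d generalizing i with
  | zero => exact capAt_cupAt h x
  | succ d ih =>
    rw [arc_succ, arc_succ, ← crossing_capAt_right T (by omega), ih (by omega)]

theorem slide_arc_left {m d : ℕ} (h : i + m + 1 ≤ p) (x : A.Box k s) :
    slide T m i (arc T d p x) = arc T d p (slide T m i x) := by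
  induction m generalizing i with
  | zero => rfl
  | succ m ih => rw [slide_succ, slide_succ, ih (by omega), crossing_arc_left T (by omega)]

end commutation

/-! ### Standard subspaces -/

/-- The standard subspace: it is spanned by the diagrams that arise from the empty one by adding
arcs. -/
noncomputable def standard (T : ∀ t, A.Box 2 t) (s : Bool) : ∀ k, Submodule ℂ (A.Box k s)
  | 0 => Submodule.span ℂ {A.emptyDiagram s}
  | k + 1 => Submodule.span ℂ
      {y | ∃ (i d : ℕ) (u : A.Box k s), i + d ≤ 2 * k ∧ u ∈ standard T s k ∧ arc T d i u = y}

variable {T : ∀ t, A.Box 2 t}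

theorem arc_mem_standard {i d : ℕ} {u : A.Box k s} (h : i + d ≤ 2 * k)
    (hu : u ∈ standard T s k) : arc T d i u ∈ standard T s (k + 1) :=
  Submodule.subset_span ⟨i, d, u, h, hu, rfl⟩

theorem cupAt_mem_standard {i : ℕ} {u : A.Box k s} (h : i ≤ 2 * k)
    (hu : u ∈ standard T s k) : cupAt i u ∈ standard T s (k + 1) :=
  arc_mem_standard (d := 0) h hu

theorem map_mem_of_mem_standard_succ {W : Type*} [AddCommGroup W] [Module ℂ W]
    {U : Submodule ℂ W} (f : A.Box (k + 1) s →ₗ[ℂ] W)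
    (h : ∀ (i d : ℕ) (u : A.Box k s), i + d ≤ 2 * k → u ∈ standard T s k → f (arc T d i u) ∈ U)
    {x : A.Box (k + 1) s} (hx : x ∈ standard T s (k + 1)) : f x ∈ U := by
  refine map_mem_of_mem_span hx f ?_
  rintro _ ⟨i, d, u, hi, hu, rfl⟩
  exact h i d u hi hu

/-- The standard subspace of `A.Box k s` is stable under crossings. -/
def CrossingStable (T : ∀ t, A.Box 2 t) (s : Bool) (k : ℕ) : Prop :=
  ∀ (i : ℕ) (u : A.Box k s), i + 2 ≤ 2 * k → u ∈ standard T s k → crossing T i u ∈ standard T s k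

/-- Local maxima map the standard subspace of `A.Box (k + 1) s` to that of `A.Box k s`. -/
def CapStable (T : ∀ t, A.Box 2 t) (s : Bool) (k : ℕ) : Prop :=
  ∀ (i : ℕ) (u : A.Box (k + 1) s), i ≤ 2 * k → u ∈ standard T s (k + 1) →
    capAt i u ∈ standard T s k

theorem CrossingStable.slide_mem (hX : CrossingStable T s k) {m i : ℕ} {u : A.Box k s}
    (h : i + m + 1 ≤ 2 * k) (hu : u ∈ standard T s k) : slide T m i u ∈ standard T s k := by
  induction m generalizing i with
  | zero => exact hu
  | succ m ih => exact hX i _ (by omega) (ih (by omega))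

/-! ### Stability under local maxima -/

section caps

variable (hT : SkeinRelations T) (hX : CrossingStable T s k)
  (hC : ∀ k', k = k' + 1 → CapStable T s k')
include hT hX hC

/-- An arc is closed off by a local maximum joining its left end to the strand on its left: the
maximum is pushed along the crossings of the arc until it meets the local minimum. -/
theorem capAt_arc_succ_mem {i d : ℕ} {u : A.Box k s} (h : i + 1 + d ≤ 2 * k)
    (hu : u ∈ standard T s k) : capAt i (arc T d (i + 1) u) ∈ standard T s k := by
  induction d generalizing i u with
  | zero => rw [arc_zero, capAt_cupAt_succ (by omega)]; exact hu
  | succ d ih =>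
    obtain ⟨k, rfl⟩ : ∃ k', k = k' + 1 := ⟨k - 1, by omega⟩
    rw [arc_succ]
    refine mem_of_mem_span (hT.cap_crossing_succ _ (by omega)) ?_
    rintro y (rfl | rfl | rfl)
    · rw [crossing_arc_left T (by omega)]
      exact ih (by omega) (hX i u (by omega) hu)
    · rw [capAt_arc_left T le_rfl]
      exact arc_mem_standard (by omega) (hC k rfl i u (by omega) hu)
    · exact ih (by omega) hu

theorem capAt_arc_mem {δ : ℂ} (hδ : A.HasModulus δ) {i d p : ℕ} {u : A.Box k s}
    (h : i + d ≤ 2 * k) (hp : p ≤ 2 * k) (hu : u ∈ standard T s k) :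
    capAt p (arc T d i u) ∈ standard T s k := by
  have A1 := @capAt_arc_succ_mem A s k T hT hX hC
  -- the local maximum joins the left end of an arc to the strand which it has crossed last
  have A2 : ∀ {p d : ℕ}, p + 1 + d ≤ 2 * k →
      capAt p (crossing T p (arc T d (p + 1) u)) ∈ standard T s k := by
    intro p d hd
    refine mem_of_mem_span (hT.cap_crossing _ (by omega)) ?_
    rintro y rfl
    exact A1 hd hu
  rcases Nat.lt_or_ge (p + 1) i with h₁ | h₁
  · obtain ⟨k, rfl⟩ : ∃ k', k = k' + 1 := ⟨k - 1, by omega⟩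
    obtain ⟨i, rfl⟩ : ∃ i', i = i' + 2 := ⟨i - 2, by omega⟩
    rw [capAt_arc_left T (by omega)]
    exact arc_mem_standard (by omega) (hC k rfl p u (by omega) hu)
  rcases h₁.eq_or_lt with rfl | h₁
  · exact A1 h hu
  obtain ⟨n, rfl⟩ : ∃ n, p = i + n := ⟨p - i, by omega⟩
  rcases Nat.lt_or_ge (d + 1) n with h₂ | h₂
  · obtain ⟨k, rfl⟩ : ∃ k', k = k' + 1 := ⟨k - 1, by omega⟩
    obtain ⟨n, rfl⟩ : ∃ n', n = n' + 2 := ⟨n - 2, by omega⟩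
    rw [← Nat.add_assoc, capAt_arc_right T (by omega)]
    exact arc_mem_standard (by omega) (hC k rfl (i + n) u (by omega) hu)
  rcases h₂.eq_or_lt with rfl | h₂
  · rw [← slide_cupAt_eq_arc, ← slide_capAt T (by omega), ← Nat.add_assoc,
      capAt_succ_cupAt (by omega)]
    exact hX.slide_mem (by omega) hu
  rcases n with _ | m
  · rcases d with _ | d
    · change capAt i (cupAt i u) ∈ _
      rw [capAt_cupAt_self hδ (by omega)]
      exact Submodule.smul_mem _ _ hu
    · exact A2 (by omega)
  · rcases (Nat.le_of_lt_succ h₂).eq_or_lt with rfl | h₂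
    · rw [← slide_arc T m 1 i u, ← slide_capAt T (by omega), arc_succ, arc_zero, ← Nat.add_assoc]
      refine map_mem_of_mem_span (hT.kink _ (by omega)) _ ?_
      rintro y rfl
      exact hX.slide_mem (by omega) hu
    · obtain ⟨d, rfl⟩ : ∃ d', d = m + (d' + 2) := ⟨d - (m + 2), by omega⟩
      rw [← slide_arc, ← slide_capAt T (by omega), arc_succ, arc_succ, ← Nat.add_assoc]
      refine hX.slide_mem (by omega) ?_
      have hq : i + m + 1 + 1 + d ≤ 2 * k := by omega
      generalize i + m = q at hq ⊢
      refine mem_of_mem_span (hT.cap_succ_crossing _ (by omega)) ?_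
      rintro y (rfl | rfl | rfl)
      · refine map_mem_of_mem_span (hT.bigon _ (by omega)) _ ?_
        rintro y (rfl | rfl | rfl)
        · obtain ⟨k, rfl⟩ : ∃ k', k = k' + 1 := ⟨k - 1, by omega⟩
          rw [capAt_arc_left T le_rfl]
          exact arc_mem_standard (by omega) (hC k rfl q u (by omega) hu)
        · rw [capAt_cupAt_succ (by omega)]
          exact A1 hq hu
        · exact A1 (d := d + 1) (by omega) hu
      · exact A1 (d := d + 1) (by omega) hu
      · exact A2 hq

end caps

/-! ### Stability under crossings -/

section crossings

variable (hT : SkeinRelations T) (hX : CrossingStable T s k)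
include hT hX

/-- The terms that occur when a crossing meets a local minimum below a strand that is pulled to the
left: the two positions of the minimum, with at most two crossings on it. -/
theorem slide_crossing_cup_mem {m i : ℕ} {v : A.Box k s} (h : i + m + 1 ≤ 2 * k)
    (hv : v ∈ standard T s k) :
    slide T m i (cupAt (i + m) v) ∈ standard T s (k + 1) ∧
    slide T m i (cupAt (i + m + 1) v) ∈ standard T s (k + 1) ∧
    slide T m i (crossing T (i + m) (cupAt (i + m + 1) v)) ∈ standard T s (k + 1) ∧
    slide T m i (crossing T (i + m + 1) (cupAt (i + m) v)) ∈ standard T s (k + 1) ∧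
    slide T m i (crossing T (i + m + 1) (crossing T (i + m) (cupAt (i + m + 1) v))) ∈
      standard T s (k + 1) ∧
    slide T m i (crossing T (i + m) (crossing T (i + m + 1) (cupAt (i + m) v))) ∈
      standard T s (k + 1) := by
  have G1 : slide T m i (cupAt (i + m) v) ∈ standard T s (k + 1) := by
    rw [← arc_zero T, slide_arc]
    exact arc_mem_standard (by omega) hv
  have G2 : slide T m i (cupAt (i + m + 1) v) ∈ standard T s (k + 1) := by
    rw [slide_cupAt T le_rfl]
    exact cupAt_mem_standard h (hX.slide_mem h hv)
  have G3 : slide T m i (crossing T (i + m) (cupAt (i + m + 1) v)) ∈ standard T s (k + 1) := by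
    rw [← arc_zero T, ← arc_succ, slide_arc]
    exact arc_mem_standard (by omega) hv
  have G4 : slide T m i (crossing T (i + m + 1) (cupAt (i + m) v)) ∈ standard T s (k + 1) := by
    refine map_mem_of_mem_span (hT.crossing_succ_cup _ h) _ ?_
    rintro y (rfl | rfl | rfl)
    exacts [G3, G1, G2]
  refine ⟨G1, G2, G3, G4, ?_, ?_⟩
  · refine map_mem_of_mem_span (hT.crossing_cup_succ _ h) (slide T m i ∘ₗ crossing T _) ?_
    rintro y (rfl | rfl | rfl)
    · refine map_mem_of_mem_span (hT.bigon _ h) _ ?_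
      rintro y (rfl | rfl | rfl)
      · exact G1
      · rw [capAt_succ_cupAt h]; exact G2
      · exact G4
    · exact G4
    · refine map_mem_of_mem_span (hT.crossing_cup _ h) _ ?_
      rintro y rfl
      exact G2
  · refine map_mem_of_mem_span (hT.crossing_succ_cup _ h) (slide T m i ∘ₗ crossing T _) ?_
    rintro y (rfl | rfl | rfl)
    · refine map_mem_of_mem_span (hT.bigon _ (by omega)) _ ?_
      rintro y (rfl | rfl | rfl)
      · exact G2
      · rw [capAt_cupAt_succ h]; exact G1
      · exact G3
    · refine map_mem_of_mem_span (hT.crossing_cup _ (by omega)) _ ?_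
      rintro y rfl
      exact G1
    · exact G3

/-- The case of the triangle move: all terms of the relation, those with fewer crossings included,
give standard elements. -/
theorem slide_triangle_mem (hC : CapStable T s k) {m i d : ℕ} {u : A.Box k s}
    (h : i + m + 2 + d ≤ 2 * k) (hu : u ∈ standard T s k) :
    slide T m i (crossing T (i + m + 1) (crossing T (i + m) (crossing T (i + m + 1)
      (arc T d (i + m + 2) u)))) ∈ standard T s (k + 1) := by
  have G := fun {v} hv => @slide_crossing_cup_mem A s k T hT hX m i v (by omega) hv
  have hu' : ∀ {q}, q ≤ i + m → crossing T q u ∈ standard T s k :=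
    fun hq => hX _ u (by omega) hu
  have hq : crossing T (i + m) (arc T d (i + m + 2) u) =
      arc T d (i + m + 2) (crossing T (i + m) u) :=
    crossing_arc_left T le_rfl u
  have c : ∀ {p : ℕ} {y : A.Box (k + 1) s}, p ≤ i + m + 1 → y ∈ standard T s (k + 1) →
      capAt p y ∈ standard T s k := fun hp hy => hC _ _ (by omega) hy
  have h₀ := arc_mem_standard (T := T) (i := i + m + 2) h hu
  have h₁ : crossing T (i + m) (arc T d (i + m + 2) u) ∈ standard T s (k + 1) :=
    hq ▸ arc_mem_standard h (hu' le_rfl)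
  have h₂ : crossing T (i + m) (crossing T (i + m + 1) (arc T d (i + m + 2) u)) ∈
      standard T s (k + 1) := arc_mem_standard (d := d + 2) (by omega) hu
  have hslide : ∀ {d p : ℕ} {v : A.Box k s}, i + m + 1 ≤ p → p + d ≤ 2 * k →
      v ∈ standard T s k → slide T m i (arc T d p v) ∈ standard T s (k + 1) := by
    intro d p v hp hd hv
    rw [slide_arc_left T hp]
    exact arc_mem_standard hd (hX.slide_mem (by omega) hv)
  refine map_mem_of_mem_span (hT.triangle _ (by omega)) (slide T m i) ?_
  rintro y (rfl | rfl | rfl | rfl | rfl | rfl | rfl | rfl | rfl | rfl | rfl | rfl | rfl | rfl)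
  · rw [hq, ← arc_succ, ← arc_succ, slide_arc]
    exact arc_mem_standard (by omega) (hu' le_rfl)
  · rw [hq, ← arc_succ]
    exact hslide le_rfl (by omega) (hu' le_rfl)
  · rw [← arc_succ, ← arc_succ, slide_arc]
    exact arc_mem_standard (by omega) hu
  · rw [hq, crossing_arc_left T le_rfl]
    exact hslide (by omega) h (hX _ _ (by omega) (hu' le_rfl))
  · rw [hq]
    exact hslide (by omega) h (hu' le_rfl)
  · exact (G (c le_rfl h₁)).2.2.1
  · exact (G (c le_rfl h₀)).2.2.2.2.1
  · exact (G (c le_rfl h₂)).2.1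
  · exact (G (c le_rfl (arc_mem_standard (d := 1) (by omega) (c le_rfl h₀)))).2.1
  · exact (G (c le_rfl h₁)).2.1
  · exact (G (c le_rfl h₀)).2.2.1
  · exact (G (c (by omega) h₀)).2.2.2.2.2
  · exact (G (c le_rfl (cupAt_mem_standard (by omega) (c (by omega) h₀)))).2.2.1
  · refine map_mem_of_mem_span (hT.crossing_cup _ (by omega)) _ ?_
    rintro y rfl
    exact (G (c (by omega) h₀)).1

theorem crossing_arc_mem (hC : CapStable T s k) {i d p : ℕ} {u : A.Box k s}
    (h : i + d ≤ 2 * k) (hp : p ≤ 2 * k) (hu : u ∈ standard T s k) :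
    crossing T p (arc T d i u) ∈ standard T s (k + 1) := by
  rcases Nat.lt_or_ge (p + 1) i with h₁ | h₁
  · rw [crossing_arc_left T (by omega)]
    exact arc_mem_standard h (hX p u (by omega) hu)
  rcases h₁.eq_or_lt with rfl | h₁
  · exact arc_mem_standard (d := d + 1) (by omega) hu
  obtain ⟨n, rfl⟩ : ∃ n, p = i + n := ⟨p - i, by omega⟩
  rcases Nat.lt_or_ge (d + 1) n with h₂ | h₂
  · obtain ⟨n, rfl⟩ : ∃ n', n = n' + 2 := ⟨n - 2, by omega⟩
    rw [← Nat.add_assoc, crossing_arc_right T (by omega)]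
    exact arc_mem_standard h (hX _ u (by omega) hu)
  rcases h₂.eq_or_lt with rfl | h₂
  · rw [← slide_cupAt_eq_arc, crossing_slide T (by omega)]
    exact (slide_crossing_cup_mem hT hX (by omega) hu).2.2.2.1
  rcases n with _ | m
  · rcases d with _ | d
    · refine mem_of_mem_span (hT.crossing_cup _ (by omega)) ?_
      rintro y rfl
      exact cupAt_mem_standard (by omega) hu
    · change crossing T i (crossing T i (arc T d (i + 1) u)) ∈ _
      have hy := arc_mem_standard (T := T) (i := i + 1) (d := d) (by omega) hu
      refine mem_of_mem_span (hT.bigon _ (by omega)) ?_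
      rintro y (rfl | rfl | rfl)
      · exact hy
      · exact cupAt_mem_standard (by omega) (hC _ _ (by omega) hy)
      · exact arc_mem_standard (d := d + 1) (by omega) hu
  · rcases (Nat.le_of_lt_succ h₂).eq_or_lt with rfl | h₂
    · rw [← slide_arc T m 1 i u, crossing_slide T (by omega), arc_succ, arc_zero]
      exact (slide_crossing_cup_mem hT hX (by omega) hu).2.2.2.2.1
    · obtain ⟨d, rfl⟩ : ∃ d', d = m + (d' + 2) := ⟨d - (m + 2), by omega⟩
      rw [← slide_arc, crossing_slide T (by omega)]
      exact slide_triangle_mem hT hX hC (by omega) hu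

end crossings

/-- Standard subspaces are stable under local maxima and under crossings. -/
theorem SkeinRelations.stable (hT : SkeinRelations T) {δ : ℂ} (hδ : A.HasModulus δ) (s : Bool)
    (k : ℕ) : CrossingStable T s k ∧ CapStable T s k := by
  have cap : ∀ k, CrossingStable T s k → (∀ k', k = k' + 1 → CapStable T s k') →
      CapStable T s k := fun k hX hC p u hp hu =>
    map_mem_of_mem_standard_succ _ (fun i d v h hv => capAt_arc_mem hT hX hC hδ h hp hv) hu
  induction k with
  | zero =>
    have hX : CrossingStable T s 0 := fun i u hi => by omega
    exact ⟨hX, cap 0 hX (by omega)⟩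
  | succ k ih =>
    have hX : CrossingStable T s (k + 1) := fun p u hp hu =>
      map_mem_of_mem_standard_succ _
        (fun i d v h hv => crossing_arc_mem hT ih.1 ih.2 h (by omega) hv) hu
    refine ⟨hX, cap _ hX ?_⟩
    rintro k' hk
    obtain rfl : k = k' := by omega
    exact ih.2

/-! ### The planar subalgebra of standard elements -/

theorem boxAt_crossing_label {i p : ℕ} (hi : i ≤ 2 * k) (hp : p + 2 ≤ 2 * j)
    (y : A.Box j (shadeAt s i)) (x : A.Box k s) :
    boxAt i (crossing T p y) x = crossing T (i + p) (boxAt i y x) := by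
  simp only [crossing]
  rw [boxAt_rectAt_label hi hp (shadeAt_shadeAt s i p), shadeAt_shadeAt]

theorem boxAt_arc_label {i d p : ℕ} (hi : i ≤ 2 * k) (hp : p + d ≤ 2 * j)
    (y : A.Box j (shadeAt s i)) (x : A.Box k s) :
    boxAt i (arc T d p y) x = arc T d (i + p) (boxAt i y x) := by
  induction d generalizing p with
  | zero => exact boxAt_cupAt_label hi hp y x
  | succ d ih =>
    rw [arc_succ, boxAt_crossing_label hi (by omega), ih (by omega)]
    rfl

/-- The disc with varying label, as a linear map. -/
noncomputable def boxLabel (i : ℕ) (x : A.Box k s) : A.Box j t →ₗ[ℂ] A.Box (k + j) s where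
  toFun y := boxAt i y x
  map_add' y z := boxAt_add i y z x
  map_smul' c y := boxAt_smul i c y x

/-- A disc labelled by a standard element may be filled with the arcs of its label. -/
theorem boxAt_mem_standard {i : ℕ} (hi : i ≤ 2 * k) {x : A.Box k s} (hx : x ∈ standard T s k)
    {y : A.Box j (shadeAt s i)} (hy : y ∈ standard T (shadeAt s i) j) :
    boxAt i y x ∈ standard T s (k + j) := by
  induction j with
  | zero =>
    refine map_mem_of_mem_span hy (boxLabel i x) ?_
    rintro y rfl
    exact (boxAt_emptyDiagram hi x).symm ▸ hx
  | succ j ih =>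
    refine map_mem_of_mem_standard_succ (boxLabel i x) ?_ hy
    intro p d u hp hu
    change boxAt i (arc T d p u) x ∈ _
    rw [boxAt_arc_label hi hp]
    exact arc_mem_standard (k := k + j) (by omega) (ih hu)

theorem SkeinRelations.act_mem (hT : SkeinRelations T) {δ : ℂ} (hδ : A.HasModulus δ)
    {k k' : ℕ} (w : Word A.Box) (h : IsTangle s (2 * k) w (2 * k'))
    (hw : ∀ l ∈ w, l.piece.LabelIn fun j t => (standard T t j : Set (A.Box j t)))
    {x : A.Box k s} (hx : x ∈ standard T s k) : act A s k k' w x ∈ standard T s k' := by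
  induction w generalizing k with
  | nil =>
    obtain rfl : k = k' := by simp only [IsTangle] at h; omega
    rwa [act_nil]
  | cons l w ih =>
    have hw' := fun l' hl' => hw l' (List.mem_cons_of_mem _ hl')
    have hl := hw l List.mem_cons_self
    obtain ⟨i, p⟩ := l
    obtain ⟨h₁, h₂, h₃⟩ := h
    cases p with
    | cup =>
      rw [← cup, act_cup_cons (i := i) h₁]
      exact ih h₃ hw' (cupAt_mem_standard h₁ hx)
    | cap =>
      simp only [Piece.dn] at h₁
      obtain ⟨k, rfl⟩ : ∃ n, k = n + 1 := ⟨k - 1, by omega⟩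
      rw [← cap, act_cap_cons (by omega)]
      exact ih h₃ hw' ((hT.stable hδ s k).2 i x (by omega) hx)
    | box j t y =>
      obtain rfl : t = shadeAt s i := h₂
      rw [← box, act_box_cons (i := i) h₁ rfl]
      refine ih ?_ hw' (boxAt_mem_standard h₁ hx hl)
      convert h₃ using 1
      simp only [Piece.dn, Piece.up]; omega

/-- The standard subspaces form a planar subalgebra. -/
noncomputable def SkeinRelations.subalgebra (hT : SkeinRelations T) {δ : ℂ}
    (hδ : A.HasModulus δ) : A.PlanarSubalgebra where
  carrier k s := standard T s k
  Z_mem k s w h hw := by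
    rw [← act_emptyDiagram h]
    exact hT.act_mem hδ w h hw (Submodule.mem_span_singleton_self _)

/-- If `R` is a standard element of a planar algebra with skein relations, the planar subalgebra
generated by `R` is evaluable. -/
theorem SkeinRelations.evaluable (hT : SkeinRelations T) {δ : ℂ} (hδ : A.HasModulus δ)
    {R : A.Box j t} (hR : R ∈ standard T t j) : (A.generatedBy R).Evaluable := by
  intro s x hx
  have hx' : x ∈ standard T s 0 := by
    simp only [generatedBy, Submodule.mem_iInf] at hx
    exact hx (hT.subalgebra hδ) hR
  obtain ⟨c, hc⟩ := Submodule.mem_span_singleton.1 hx'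
  exact ⟨c, hc.symm⟩

/-! ### Rotation and composition of `2`-boxes -/

/-- The two vertical strands, as a `2`-box in either shading. -/
noncomputable def unit (A : PlanarAlgebra.{u}) (t : Bool) : A.Box 2 t :=
  cupAt 1 (cupAt 0 (A.emptyDiagram t))

/-- The `2`-box of either shading in which one strand joins the points at the bottom and one
strand those at the top. -/
noncomputable def hunit (A : PlanarAlgebra.{u}) (t : Bool) : A.Box 2 t :=
  cupAt 0 (cupAt 0 (A.emptyDiagram t))

theorem one₂_eq : A.one₂ = A.unit false := by
  rw [one₂, ← act_emptyDiagram]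
  change act A false 0 2 [cup 0, cup 1] _ = _
  rw [act_cup_cons (by omega), act_cup_cons (by omega), act_nil]
  rfl

theorem hone₂_eq : A.hone₂ = A.hunit false := by
  rw [hone₂, ← act_emptyDiagram]
  change act A false 0 2 [cup 0, cup 1, cap 0, cup 0] _ = _
  rw [act_cup_cons (by omega), act_cup_cons (by omega), act_cap_cons (by omega),
    act_cup_cons (by omega), act_nil, capAt_cupAt_succ (by omega)]
  rfl

section

variable {i : ℕ}

/-- Two nested local minima whose right ends are bent down again. -/
theorem capAt_capAt_cupAt_cupAt (hi : i + 2 ≤ 2 * k) (x : A.Box k s) :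
    capAt (i + 2) (capAt (i + 3) (cupAt (i + 1) (cupAt i x))) = x := by
  rw [capAt_cupAt (i := i + 1) (p := i + 1) le_rfl, capAt_succ_cupAt (i := i) (by omega),
    capAt_succ_cupAt (i := i + 1) (by omega)]

theorem rectAt_unit (hi : i ≤ 2 * k) (ht : t = shadeAt s i) (x : A.Box (k + 1) s) :
    rectAt i (A.unit t) x = x := by
  subst ht
  rw [rectAt_apply, unit, boxAt_cupAt_label (by omega) (by omega),
    boxAt_cupAt_label (by omega) (by omega), boxAt_emptyDiagram (by omega)]
  exact capAt_capAt_cupAt_cupAt (by omega) x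

theorem rectAt_hunit (hi : i ≤ 2 * k) (ht : t = shadeAt s i) (x : A.Box (k + 1) s) :
    rectAt i (A.hunit t) x = cupAt i (capAt i x) := by
  subst ht
  rw [rectAt_apply, hunit, boxAt_cupAt_label (by omega) (by omega),
    boxAt_cupAt_label (by omega) (by omega), boxAt_emptyDiagram (by omega)]
  simp only [Nat.add_zero]
  rw [capAt_cupAt (i := i) (p := i + 1) (by omega), capAt_succ_cupAt (by omega),
    capAt_cupAt le_rfl]

theorem rectAt_combination (hi : i ≤ 2 * k) (ht : t = shadeAt s i) (p q r : ℂ) (y : A.Box 2 t)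
    (x : A.Box (k + 1) s) :
    rectAt i (p • y + q • A.unit t + r • A.hunit t) x =
      p • rectAt i y x + q • x + r • cupAt i (capAt i x) := by
  rw [rectAt_add, rectAt_add, rectAt_smul, rectAt_smul, rectAt_smul, rectAt_unit hi ht,
    rectAt_hunit hi ht]

theorem isTangle_rot (y : A.Box 2 t) : IsTangle (!t) 0 [cup 0, box 1 y, cap 4] (2 * 2) := by
  simp [IsTangle, cup, cap, box, Piece.dn, Piece.up, Piece.Fits, shadeAt]

theorem rot_eq (y : A.Box 2 t) :
    A.rot y = capAt 4 (boxAt 1 y (cupAt 0 (A.emptyDiagram (!t)))) := by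
  refine (act_emptyDiagram (isTangle_rot y)).symm.trans ?_
  rw [act_cup_cons (by omega),
    act_box_cons (by omega) (by simp [shadeAt]), act_cap_cons (by omega), act_nil]

theorem rot_unit : A.rot (A.unit t) = A.hunit (!t) := by
  obtain ⟨s, rfl⟩ : ∃ s, t = shadeAt s 1 := ⟨!t, by simp [shadeAt]⟩
  have hs : (!shadeAt s 1) = s := by simp [shadeAt]
  rw [rot_eq, hs, unit, boxAt_cupAt_label (by omega) (by omega),
    boxAt_cupAt_label (by omega) (by omega), boxAt_emptyDiagram (by omega),
    capAt_cupAt (i := 2) (p := 2) le_rfl, capAt_succ_cupAt (i := 1) (by omega), hunit]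
  exact cupAt_cupAt (i := 0) (p := 0) le_rfl _

theorem rot_hunit : A.rot (A.hunit t) = A.unit (!t) := by
  obtain ⟨s, rfl⟩ : ∃ s, t = shadeAt s 1 := ⟨!t, by simp [shadeAt]⟩
  have hs : (!shadeAt s 1) = s := by simp [shadeAt]
  rw [rot_eq, hs, hunit, boxAt_cupAt_label (by omega) (by omega),
    boxAt_cupAt_label (by omega) (by omega), boxAt_emptyDiagram (by omega),
    capAt_cupAt (i := 1) (p := 2) (by omega), capAt_succ_cupAt (i := 1) (by omega), unit]

theorem rot_combination (p q r : ℂ) (y : A.Box 2 t) :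
    A.rot (p • y + q • A.unit t + r • A.hunit t) =
      p • A.rot y + r • A.unit (!t) + q • A.hunit (!t) := by
  rw [← rot_unit, ← rot_hunit]
  simp only [rot_eq, boxAt_add, boxAt_smul, map_add, map_smul]
  abel

/-- The rotation of a rectangle, drawn with the help of a local minimum and a local maximum. -/
theorem rectAt_rot (hi : i ≤ 2 * k) (y : A.Box 2 t) (x : A.Box (k + 1) s) :
    rectAt i (A.rot y) x = capAt (i + 2) (rectAt (i + 1) y (cupAt i x)) := by
  by_cases ht : t = shadeAt s (i + 1)
  · have h : boxAt i (A.rot y) x =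
        act A s (k + 1) (k + 1 + 2) [cup i, box (i + 1) y, cap (i + 4)] x :=
      boxAt_Z (by omega) (by rw [ht, shadeAt_succ, Bool.not_not]) (isTangle_rot y) x
    rw [rectAt_apply, h, act_cup_cons (by omega), act_box_cons (by omega) ht]
    rw [act_cap_cons (k := k + 3) (by omega), act_nil]
    rfl
  · rw [rectAt_apply, rectAt_apply, boxAt_of_shade_ne ht, boxAt_of_shade_ne]
    · simp
    · rw [shadeAt_succ] at ht
      rintro h
      rw [← h, Bool.not_not] at ht
      exact ht rfl

/-- A crossing on the right leg of a local minimum is pulled over to the left leg. -/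
theorem rectAt_succ_cupAt (hi : i + 1 ≤ 2 * k) (y : A.Box 2 t) (x : A.Box k s) :
    rectAt (i + 1) y (cupAt i x) = rectAt i (A.rot y) (cupAt (i + 1) x) := by
  rw [rectAt_rot (by omega), ← cupAt_cupAt (i := i) (p := i + 1) (by omega),
    rectAt_cupAt_right (i := i + 1) (p := i + 3) le_rfl,
    capAt_cupAt_succ (i := i + 2) (by omega)]

/-- A crossing below the left end of a local maximum is pulled over to the right end. -/
theorem capAt_succ_rectAt (hi : i + 1 ≤ 2 * k) (y : A.Box 2 t) (x : A.Box (k + 1) s) :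
    capAt (i + 1) (rectAt i y x) = capAt i (rectAt (i + 1) (A.rot y) x) := by
  rw [rectAt_rot (by omega), ← capAt_capAt (i := i) (p := i + 1) (by omega),
    ← rectAt_capAt_left le_rfl, capAt_cupAt_succ (by omega)]

theorem rectAt_stack (hi : i + 2 ≤ 2 * k) (ht : shadeAt s i = false) (a b : A.Box 2 false)
    (x : A.Box k s) : rectAt i (A.stack a b) x = rectAt i b (rectAt i a x) := by
  rw [rectAt_apply, stack, boxAt_Z (by omega) ht.symm]
  change capAt (i + 2) (capAt (i + 3) (act A s k (k + 2)
    [cup i, cup (i + 1), box i a, cap (i + 3), cap (i + 2), box i b, cap (i + 3), cap (i + 2)]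
    x)) = _
  rw [act_cup_cons (by omega), act_cup_cons (by omega), act_rect_append (by omega) ht.symm,
    act_rect_append (by omega) ht.symm, act_nil, ← rectAt_capAt_right (by omega),
    ← rectAt_capAt_right (by omega), ← rectAt_capAt_right (by omega),
    ← rectAt_capAt_right (by omega), capAt_capAt_cupAt_cupAt hi]

theorem rectAt_beside (hi : i + 2 ≤ 2 * k) (ht : shadeAt s i = false) (a b : A.Box 2 false)
    (x : A.Box k s) : rectAt i (A.beside a b) x =
      capAt (i + 1) (rectAt (i + 2) b (rectAt i a (cupAt (i + 1) x))) := by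
  rw [rectAt_apply, beside, boxAt_Z (by omega) ht.symm]
  change capAt (i + 2) (capAt (i + 3) (act A s k (k + 2)
    [cup i, cup (i + 1), cup (i + 1), box i a, cap (i + 3), cap (i + 2), box (i + 2) b,
      cap (i + 2 + 3), cap (i + 2 + 2), cap (i + 1)] x)) = _
  rw [act_cup_cons (by omega), act_cup_cons (by omega), act_cup_cons (by omega),
    act_rect_append (by omega) ht.symm,
    act_rect_append (by omega) (by rw [shadeAt_add_two, ht]), act_cap_cons (by omega), act_nil,
    capAt_capAt (i := i + 1) (p := i + 3) (by omega),
    capAt_capAt (i := i + 1) (p := i + 2) (by omega),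
    ← rectAt_capAt_right (i := i + 2) (p := i + 5) (by omega),
    ← rectAt_capAt_right (i := i) (p := i + 5) (by omega),
    ← rectAt_capAt_right (i := i + 2) (p := i + 4) (by omega),
    ← rectAt_capAt_right (i := i) (p := i + 4) (by omega),
    capAt_cupAt (i := i + 1) (p := i + 3) (by omega),
    capAt_cupAt (i := i + 1) (p := i + 2) (by omega), capAt_capAt_cupAt_cupAt hi]

/-- A clockwise quarter turn makes horizontal composition vertical. -/
theorem rectAt_rot_beside (hi : i ≤ 2 * k) (ht : shadeAt s i = true) (a b : A.Box 2 false)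
    (x : A.Box (k + 1) s) :
    rectAt i (A.rot (A.beside a b)) x = rectAt i (A.rot a) (rectAt i (A.rot b) x) := by
  rw [rectAt_rot hi, rectAt_beside (by omega) (by rw [shadeAt_succ, ht]; rfl),
    cupAt_cupAt (i := i) (p := i) le_rfl, rectAt_succ_cupAt (by omega),
    rectAt_comm (i := i) (p := i + 3) (by omega),
    rectAt_cupAt_left (i := i + 1) (p := i + 1) le_rfl,
    ← rectAt_capAt_right (i := i) (p := i + 2) le_rfl,
    capAt_succ_cupAt (i := i + 1) (by omega),
    ← rectAt_capAt_right (i := i) (p := i + 2) le_rfl, ← rectAt_rot hi]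

theorem capAt_rectAt_cupAt_of_capRight {y : A.Box 2 t} {c : ℂ}
    (h : A.capRight y = c • A.strand t) (hi : i + 1 ≤ 2 * k) (ht : t = shadeAt s i)
    (x : A.Box k s) : capAt (i + 1) (rectAt i y (cupAt (i + 1) x)) = c • x := by
  have h₁ : boxAt i (A.capRight y) x =
      capAt (i + 1) (rectAt i y (cupAt (i + 1) (cupAt i x))) := by
    rw [capRight, boxAt_Z (by omega) ht]
    change act A s k (k + 1) [cup i, cup (i + 1), box i y, cap (i + 3), cap (i + 2), cap (i + 1)]
      x = _
    rw [act_cup_cons (by omega), act_cup_cons (by omega), act_rect_append (by omega) ht,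
      act_cap_cons (by omega), act_nil]
  have h₂ : boxAt i (A.strand t) x = cupAt i x := by
    rw [strand, boxAt_Z (by omega) ht]
    change act A s k (k + 1) [cup i] x = _
    rfl
  rw [h, boxAt_smul, h₂] at h₁
  have h₃ := congrArg (capAt (i + 1)) h₁
  rw [map_smul, capAt_succ_cupAt hi, capAt_capAt (i := i + 1) (p := i + 1) le_rfl,
    ← rectAt_capAt_right (by omega), capAt_cupAt (i := i + 1) (p := i + 1) le_rfl,
    capAt_succ_cupAt hi] at h₃
  exact h₃.symm

theorem capAt_capAt_capAt_cupAt_cupAt_cupAt (hi : i + 3 ≤ 2 * k) (x : A.Box k s) :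
    capAt (i + 3) (capAt (i + 4) (capAt (i + 5) (cupAt (i + 2) (cupAt (i + 1) (cupAt i x))))) =
      x := by
  rw [capAt_cupAt (i := i + 2) (p := i + 3) (by omega),
    capAt_cupAt (i := i + 2) (p := i + 2) le_rfl, capAt_capAt_cupAt_cupAt (by omega),
    capAt_succ_cupAt (i := i + 2) (by omega)]

/-- The `3`-box, drawn as a rectangle, acts as the composite of its three crossings. -/
theorem boxAt_zigLeft (hi : i + 3 ≤ 2 * k) (ht : shadeAt s i = false) (a : A.Box 2 false)
    (b : A.Box 2 true) (c : A.Box 2 false) (x : A.Box k s) :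
    capAt (i + 3) (capAt (i + 4) (capAt (i + 5) (boxAt i (A.zigLeft a b c) x))) =
      rectAt i c (rectAt (i + 1) b (rectAt i a x)) := by
  rw [zigLeft, boxAt_Z (by omega) ht.symm]
  change capAt (i + 3) (capAt (i + 4) (capAt (i + 5) (act A s k (k + 3)
    [cup i, cup (i + 1), cup (i + 2), box i a, cap (i + 3), cap (i + 2), box (i + 1) b,
      cap (i + 1 + 3), cap (i + 1 + 2), box i c, cap (i + 3), cap (i + 2)] x))) = _
  rw [act_cup_cons (by omega), act_cup_cons (by omega), act_cup_cons (by omega),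
    act_rect_append (by omega) ht.symm,
    act_rect_append (by omega) (by rw [shadeAt_succ, ht]; rfl),
    act_rect_append (by omega) ht.symm, act_nil]
  iterate 9 rw [← rectAt_capAt_right (by omega)]
  rw [capAt_capAt_capAt_cupAt_cupAt_cupAt hi]

theorem boxAt_zigRight (hi : i + 3 ≤ 2 * k) (ht : shadeAt s i = false) (a : A.Box 2 true)
    (b : A.Box 2 false) (c : A.Box 2 true) (x : A.Box k s) :
    capAt (i + 3) (capAt (i + 4) (capAt (i + 5) (boxAt i (A.zigRight a b c) x))) =
      rectAt (i + 1) c (rectAt i b (rectAt (i + 1) a x)) := by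
  have ht' : true = shadeAt s (i + 1) := by rw [shadeAt_succ, ht]; rfl
  rw [zigRight, boxAt_Z (by omega) ht.symm]
  change capAt (i + 3) (capAt (i + 4) (capAt (i + 5) (act A s k (k + 3)
    [cup i, cup (i + 1), cup (i + 2), box (i + 1) a, cap (i + 1 + 3), cap (i + 1 + 2), box i b,
      cap (i + 3), cap (i + 2), box (i + 1) c, cap (i + 1 + 3), cap (i + 1 + 2)] x))) = _
  rw [act_cup_cons (by omega), act_cup_cons (by omega), act_cup_cons (by omega),
    act_rect_append (by omega) ht', act_rect_append (by omega) ht.symm,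
    act_rect_append (by omega) ht', act_nil]
  iterate 9 rw [← rectAt_capAt_right (by omega)]
  rw [capAt_capAt_capAt_cupAt_cupAt_cupAt hi]

/-- One side of a triangle move, turned by one click. -/
theorem capAt_rectAt_left_cupAt {t₁ t₂ t₃ : Bool} (hi : i + 1 ≤ 2 * k) (a : A.Box 2 t₁)
    (b : A.Box 2 t₂) (c : A.Box 2 t₃) (x : A.Box (k + 1) s) :
    capAt (i + 3) (rectAt (i + 1) c (rectAt (i + 2) b (rectAt (i + 1) a (cupAt i x)))) =
      rectAt (i + 1) c (rectAt i (A.rot a) (rectAt (i + 1) (A.rot b) x)) := by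
  rw [rectAt_succ_cupAt (by omega), rectAt_comm le_rfl,
    rectAt_succ_cupAt (i := i + 1) (by omega)]
  iterate 3 rw [← rectAt_capAt_right (by omega)]
  rw [capAt_succ_cupAt (i := i + 2) (by omega)]

/-- The other side of a triangle move, turned by one click. -/
theorem capAt_rectAt_right_cupAt {t₁ t₂ t₃ : Bool} (hi : i + 1 ≤ 2 * k) (a : A.Box 2 t₁)
    (b : A.Box 2 t₂) (c : A.Box 2 t₃) (x : A.Box (k + 1) s) :
    capAt (i + 3) (rectAt (i + 2) c (rectAt (i + 1) b (rectAt (i + 2) a (cupAt i x)))) =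
      rectAt i (A.rot b) (rectAt (i + 1) (A.rot c) (rectAt i a x)) := by
  rw [rectAt_cupAt_left le_rfl, capAt_succ_rectAt (i := i + 2) (by omega),
    rectAt_comm (i := i + 1) (p := i + 3) (by omega),
    rectAt_cupAt_left (i := i) (p := i + 1) (by omega), ← rectAt_rot (by omega)]

/-- The value of a kink does not depend on the side on which its loop is, up to rotation of the
crossing: here the loop is below. -/
theorem rectAt_rot_cupAt {y : A.Box 2 t} {c : ℂ}
    (h : ∀ x : A.Box (k + 1) s, capAt (i + 2) (rectAt (i + 1) y (cupAt (i + 2) x)) = c • x)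
    (hi : i ≤ 2 * k) (x : A.Box k s) : rectAt i (A.rot y) (cupAt i x) = c • cupAt i x := by
  rw [← capAt_succ_cupAt (i := i) (k := k + 1) (by omega) (rectAt i (A.rot y) (cupAt i x)),
    ← rectAt_cupAt_left le_rfl, ← cupAt_cupAt (i := i) (p := i) le_rfl,
    ← capAt_succ_rectAt (i := i + 1) (by omega), h]

/-- A kink whose loop is above. -/
theorem capAt_rectAt_of_rot {y : A.Box 2 t} {c : ℂ}
    (h : ∀ x : A.Box (k + 1) s, capAt (i + 2) (rectAt (i + 1) (A.rot y) (cupAt (i + 2) x)) = c • x)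
    (hi : i ≤ 2 * k) (x : A.Box (k + 1) s) : capAt i (rectAt i y x) = c • capAt i x := by
  conv_lhs => rw [← capAt_cupAt_succ (i := i) (k := k + 1) (by omega) x]
  rw [rectAt_capAt_left le_rfl, capAt_capAt le_rfl, rectAt_succ_cupAt (i := i + 1) (by omega), h,
    map_smul]

end

/-! ### Skein relations of a family that is stable under rotation -/

theorem mem_span_of_combination {V : Type*} [AddCommGroup V] [Module ℂ V] {x y z w : V}
    {p q r : ℂ} (h : x = p • y + q • z + r • w) : x ∈ Submodule.span ℂ {y, z, w} :=
  Submodule.mem_span_triple.2 ⟨p, q, r, h.symm⟩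

theorem mem_span_of_combination_left {V : Type*} [AddCommGroup V] [Module ℂ V] {x y z w : V}
    {p q r : ℂ} (hp : p ≠ 0) (h : x = p • y + q • z + r • w) :
    y ∈ Submodule.span ℂ {x, z, w} := by
  refine Submodule.mem_span_triple.2 ⟨p⁻¹, -(p⁻¹ * q), -(p⁻¹ * r), ?_⟩
  rw [h]
  simp only [smul_add, smul_smul, inv_mul_cancel₀ hp]
  module

theorem crossing_eq (T : ∀ t, A.Box 2 t) {i : ℕ} {b : Bool} (h : shadeAt s i = b) :
    (crossing T i : A.Box k s →ₗ[ℂ] A.Box k s) = rectAt i (T b) := by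
  subst h; rfl

/-- A family of crossings that is invariant under rotation up to non-zero scalars and
Temperley-Lieb elements, and which satisfies one kink, the bigon and the triangle relations,
satisfies all the skein relations. -/
theorem SkeinRelations.of_rot {T : ∀ t, A.Box 2 t} {δ : ℂ} (hδ : A.HasModulus δ)
    (hrot : ∀ {s k i}, i ≤ 2 * k → ∃ p q r : ℂ, p ≠ 0 ∧ ∀ x : A.Box (k + 1) s,
      rectAt i (A.rot (T (shadeAt s (i + 1)))) x =
        p • crossing T i x + q • x + r • cupAt i (capAt i x))
    (hkink : ∀ s i, ∃ c : ℂ, ∀ {k} (x : A.Box k s), i + 1 ≤ 2 * k →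
      capAt (i + 1) (crossing T i (cupAt (i + 1) x)) = c • x)
    (hbigon : ∀ {s k i} (x : A.Box (k + 1) s), i ≤ 2 * k →
      crossing T i (crossing T i x) ∈
        Submodule.span ℂ {x, cupAt i (capAt i x), crossing T i x})
    (htriangle : ∀ {s k i} (x : A.Box (k + 1) s), i + 1 ≤ 2 * k →
      crossing T (i + 1) (crossing T i (crossing T (i + 1) x)) ∈
        Submodule.span ℂ {
          crossing T i (crossing T (i + 1) (crossing T i x)),
          crossing T (i + 1) (crossing T i x),
          crossing T i (crossing T (i + 1) x),
          crossing T i (crossing T i x),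
          crossing T i x,
          crossing T i (cupAt (i + 1) (capAt (i + 1) (crossing T i x))),
          crossing T (i + 1) (crossing T i (cupAt (i + 1) (capAt (i + 1) x))),
          cupAt (i + 1) (capAt (i + 1) (crossing T i (crossing T (i + 1) x))),
          cupAt (i + 1) (capAt (i + 1) (crossing T i (cupAt (i + 1) (capAt (i + 1) x)))),
          cupAt (i + 1) (capAt (i + 1) (crossing T i x)),
          crossing T i (cupAt (i + 1) (capAt (i + 1) x)),
          crossing T i (crossing T (i + 1) (cupAt i (capAt i x))),
          crossing T i (cupAt (i + 1) (capAt (i + 1) (cupAt i (capAt i x)))),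
          crossing T i (cupAt i (capAt i x))}) : SkeinRelations T := by
  have hcap : ∀ {s k i}, i + 1 ≤ 2 * k → ∃ p q r : ℂ, p ≠ 0 ∧ ∀ x : A.Box (k + 1) s,
      capAt (i + 1) (crossing T i x) =
        p • capAt i (crossing T (i + 1) x) + q • capAt i x + r • capAt (i + 1) x := by
    intro s k i hi
    obtain ⟨p, q, r, hp, h⟩ := hrot (s := s) (i := i + 1) (k := k) hi
    refine ⟨p, q, r, hp, fun x => ?_⟩
    rw [crossing, capAt_succ_rectAt hi, ← shadeAt_add_two s i, h]
    simp only [map_add, map_smul, capAt_cupAt_succ hi]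
  have hcup : ∀ {s k i}, i + 1 ≤ 2 * k → ∃ p q r : ℂ, p ≠ 0 ∧ ∀ x : A.Box k s,
      crossing T (i + 1) (cupAt i x) =
        p • crossing T i (cupAt (i + 1) x) + r • cupAt i x + q • cupAt (i + 1) x := by
    intro s k i hi
    obtain ⟨p, q, r, hp, h⟩ := hrot (s := s) (i := i) (k := k) (by omega)
    refine ⟨p, q, r, hp, fun x => ?_⟩
    rw [crossing, rectAt_succ_cupAt hi, h, capAt_cupAt_succ hi]
    module
  refine ⟨hbigon, ?_, ?_, ?_, ?_, ?_, ?_, ?_, htriangle⟩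
  · intro s k i x hi
    obtain ⟨p, q, r, hp, h⟩ := hrot (s := s) (i := i + 1) (k := k + 1) (by omega)
    obtain ⟨c, hc⟩ := hkink s (i + 1)
    refine Submodule.mem_span_singleton.2 ⟨p * c + q * δ + r, ?_⟩
    refine (capAt_rectAt_of_rot (c := p * c + q * δ + r) (fun y => ?_) hi x).symm
    rw [← shadeAt_add_two s i, h]
    simp only [map_add, map_smul]
    rw [hc y (by omega), capAt_cupAt_self hδ (by omega), capAt_cupAt_succ (by omega),
      capAt_succ_cupAt (by omega)]
    module
  · intro s k i x hi
    obtain ⟨p, q, r, hp, h⟩ := hrot (s := s) (i := i) (k := k) hi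
    obtain ⟨c, hc⟩ := hkink s (i + 1)
    have h₁ := rectAt_rot_cupAt (k := k) (fun y => hc y (by omega)) hi x
    rw [h, capAt_cupAt_self hδ hi] at h₁
    have h₂ : p • crossing T i (cupAt i x) =
        c • cupAt i x - q • cupAt i x - r • cupAt i (δ • x) := by
      rw [← h₁]; abel
    refine Submodule.mem_span_singleton.2 ⟨p⁻¹ * (c - q - r * δ), ?_⟩
    rw [← inv_smul_smul₀ hp (crossing T i (cupAt i x)), h₂, map_smul]
    module
  · intro s k i x hi
    obtain ⟨c, hc⟩ := hkink s i
    exact Submodule.mem_span_singleton.2 ⟨c, (hc x hi).symm⟩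
  · intro s k i x hi
    obtain ⟨p, q, r, hp, h⟩ := hcap (s := s) (i := i) (k := k) hi
    exact mem_span_of_combination_left hp (h x)
  · intro s k i x hi
    obtain ⟨p, q, r, hp, h⟩ := hcap (s := s) (i := i) (k := k) hi
    exact mem_span_of_combination (h x)
  · intro s k i x hi
    obtain ⟨p, q, r, hp, h⟩ := hcup (s := s) (i := i) (k := k) hi
    exact mem_span_of_combination (h x)
  · intro s k i x hi
    obtain ⟨p, q, r, hp, h⟩ := hcup (s := s) (i := i) (k := k) hi
    exact mem_span_of_combination_left hp (h x)

/-! ### Temperley-Lieb elements -/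

theorem rectAt_zero (i : ℕ) (x : A.Box k s) : rectAt i (0 : A.Box 2 t) x = 0 := by
  have := rectAt_smul i (0 : ℂ) (0 : A.Box 2 t) x
  rwa [zero_smul, zero_smul] at this

theorem crossing_zero (i : ℕ) (x : A.Box k s) :
    crossing (fun _ => (0 : A.Box 2 _)) i x = 0 := rectAt_zero i x

theorem skeinRelations_zero : SkeinRelations (A := A) fun _ => 0 := by
  constructor <;> intros <;> simp only [crossing_zero, map_zero] <;> exact Submodule.zero_mem _

theorem temperleyLieb_le_standard {δ : ℂ} (hδ : A.HasModulus δ) (k : ℕ) (s : Bool) :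
    A.temperleyLieb k s ≤ standard (fun _ => 0) s k := by
  refine Submodule.span_le.2 ?_
  rintro _ ⟨w, h, hw, rfl⟩
  refine (skeinRelations_zero.subalgebra hδ).Z_mem k s w h fun l hl => ?_
  have := hw l hl
  rcases l with ⟨i, _ | _ | _⟩ <;> simp_all [Piece.IsString, Piece.LabelIn]

theorem mem_span_of_mem_temperleyLieb {δ : ℂ} (hδ : A.HasModulus δ) {x : A.Box 2 s}
    (hx : x ∈ A.temperleyLieb 2 s) : ∃ p q : ℂ, x = p • A.unit s + q • A.hunit s := by
  have h := temperleyLieb_le_standard hδ 2 s hx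
  suffices h : x ∈ Submodule.span ℂ {A.unit s, A.hunit s} by
    obtain ⟨p, q, h⟩ := Submodule.mem_span_pair.1 h
    exact ⟨p, q, h.symm⟩
  refine map_mem_of_mem_standard_succ LinearMap.id ?_ h
  rintro i (_ | d) u hi hu
  · refine map_mem_of_mem_standard_succ (cupAt i) ?_ hu
    rintro i' (_ | d') v hi' hv
    · obtain rfl : i' = 0 := by omega
      refine map_mem_of_mem_span hv (cupAt i ∘ₗ cupAt 0) ?_
      rintro y rfl
      have : i = 0 ∨ i = 1 ∨ i = 2 := by omega
      obtain rfl | rfl | rfl := this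
      · exact Submodule.subset_span (.inr rfl)
      · exact Submodule.subset_span (.inl rfl)
      · refine Submodule.subset_span (.inr ?_)
        exact cupAt_cupAt (i := 0) (p := 0) le_rfl _
    · rw [arc_succ, crossing_zero, map_zero]
      exact Submodule.zero_mem _
  · rw [arc_succ, crossing_zero, map_zero]
    exact Submodule.zero_mem _

theorem unit_mem_standard (T : ∀ t, A.Box 2 t) : A.unit s ∈ standard T s 2 :=
  cupAt_mem_standard (k := 1) (by omega)
    (cupAt_mem_standard (k := 0) (by omega) (Submodule.mem_span_singleton_self _))

theorem hunit_mem_standard (T : ∀ t, A.Box 2 t) : A.hunit s ∈ standard T s 2 :=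
  cupAt_mem_standard (k := 1) (by omega)
    (cupAt_mem_standard (k := 0) (by omega) (Submodule.mem_span_singleton_self _))

theorem rectAt_zero_unit (y : A.Box 2 s) : rectAt 0 y (A.unit s) = y := by
  rw [unit, rectAt_cupAt_cupAt (k := 0) (by omega)]
  exact (act_emptyDiagram (k := 2) (s := s) (w := [box 0 y])
    (isTangle_box_cons.2 rfl)).trans (A.Z_box 2 s y _)

/-! ### The relations of a quadratic braiding -/

namespace IsQuadraticBraidingWith

variable {σ a : ℂ} {R R' : A.Box 2 false} {i : ℕ}

theorem rectAt_inv_rectAt (h : A.IsQuadraticBraidingWith σ R R' a) (hi : i ≤ 2 * k)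
    (ht : shadeAt s i = false) (x : A.Box (k + 1) s) : rectAt i R' (rectAt i R x) = x := by
  rw [← rectAt_stack (by omega) ht, h.stack_inv, one₂_eq, rectAt_unit hi ht.symm]

/-- Horizontal invertibility, after a quarter turn. -/
theorem rectAt_rot_rectAt_rot_inv (h : A.IsQuadraticBraidingWith σ R R' a) (hi : i ≤ 2 * k)
    (ht : shadeAt s i = true) (x : A.Box (k + 1) s) :
    rectAt i (A.rot R) (rectAt i (A.rot (A.rotTwo R')) x) = x := by
  rw [← rectAt_rot_beside hi ht, h.beside_inv, hone₂_eq, rot_hunit]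
  exact rectAt_unit hi ht.symm x

theorem rectAt_braid (h : A.IsQuadraticBraidingWith σ R R' a) (hσ : σ ≠ 0) (hi : i + 1 ≤ 2 * k)
    (ht : shadeAt s i = false) (x : A.Box (k + 1) s) :
    rectAt i R (rectAt (i + 1) (A.rot R') (rectAt i R x)) =
      σ • rectAt (i + 1) (A.rot R') (rectAt i R (rectAt (i + 1) (A.rot R') x)) := by
  have h₁ := congrArg
    (fun z : A.Box 3 false => capAt (i + 3) (capAt (i + 4) (capAt (i + 5) (boxAt i z x)))) h.braid
  simp only [boxAt_smul, map_smul] at h₁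
  rw [boxAt_zigLeft (by omega) ht, boxAt_zigRight (by omega) ht, pow_two, ← smul_smul] at h₁
  exact smul_right_injective _ hσ h₁

/-- The braid relation, turned by one click. -/
theorem rectAt_braid_rot (h : A.IsQuadraticBraidingWith σ R R' a) (hσ : σ ≠ 0)
    (hi : i + 1 ≤ 2 * k) (ht : shadeAt s i = true) (x : A.Box (k + 1) s) :
    rectAt (i + 1) R (rectAt i (A.rot R) (rectAt (i + 1) (A.rotTwo R') x)) =
      σ • rectAt i (A.rot R) (rectAt (i + 1) (A.rotTwo R') (rectAt i (A.rot R') x)) := by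
  have h₁ := congrArg (capAt (i + 3)) (h.rectAt_braid hσ (i := i + 1) (k := k + 1) (by omega)
    (by rw [shadeAt_succ, ht]; rfl) (cupAt i x))
  rw [map_smul, capAt_rectAt_left_cupAt hi, capAt_rectAt_right_cupAt hi] at h₁
  exact h₁

theorem capAt_rectAt (h : A.IsQuadraticBraidingWith σ R R' a) (hi : i ≤ 2 * k)
    (ht : shadeAt s i = false) (x : A.Box (k + 1) s) :
    capAt i (rectAt i R x) = (σ * a⁻¹) • capAt i x :=
  capAt_rectAt_of_rot (fun y => capAt_rectAt_cupAt_of_capRight h.twist_top (by omega)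
    (by rw [shadeAt_succ, ht]) y) hi x

theorem exists_quadratic (h : A.IsQuadraticBraidingWith σ R R' a) {δ : ℂ} (hδ : A.HasModulus δ) :
    ∃ α β c : ℂ, A.stack R R = c • R + α • A.unit false + β • A.hunit false := by
  obtain ⟨y, hy, z, hz, e⟩ := Submodule.mem_sup.1 h.quadratic
  obtain ⟨α, β, rfl⟩ := mem_span_of_mem_temperleyLieb hδ hy
  obtain ⟨c, rfl⟩ := Submodule.mem_span_singleton.1 hz
  exact ⟨α, β, c, by rw [← e]; abel⟩

/-- Multiplication of the quadratic relation by the inverse: `R` is a combination of its inverse and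
of Temperley-Lieb elements. -/
theorem eq_combination_inv (h : A.IsQuadraticBraidingWith σ R R' a) (hσ : σ ≠ 0) {α β c : ℂ}
    (hq : A.stack R R = c • R + α • A.unit false + β • A.hunit false) :
    R = α • R' + c • A.unit false + (β * σ⁻¹ * a) • A.hunit false := by
  have ht : shadeAt false 0 = false := rfl
  set X : A.Box 2 false →ₗ[ℂ] A.Box 2 false := rectAt 0 R with hX
  set X' : A.Box 2 false →ₗ[ℂ] A.Box 2 false := rectAt 0 R' with hX'
  set e : A.Box 2 false →ₗ[ℂ] A.Box 2 false := cupAt 0 ∘ₗ capAt 0 with he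
  have hX'X : ∀ x, X' (X x) = x := fun x => h.rectAt_inv_rectAt (k := 1) (by omega) ht x
  have heX : ∀ x, e (X x) = (σ * a⁻¹) • e x := fun x => by
    simp only [he, hX, LinearMap.comp_apply]
    rw [h.capAt_rectAt (k := 1) (by omega) ht, map_smul]
  have hXX : ∀ x, X (X x) = c • X x + α • x + β • e x := fun x => by
    rw [hX, ← rectAt_stack (by omega) ht, hq, rectAt_combination (k := 1) (by omega) ht.symm]
    rfl
  have ha := h.a_ne_zero
  -- comparison of the two ways to expand the cube of `R`
  have h₁ : ∀ x, β • X (e x) = (β * (σ * a⁻¹)) • e x := fun x => by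
    have h₂ := congrArg X (hXX x)
    rw [hXX (X x), heX] at h₂
    simp only [map_add, map_smul] at h₂
    rw [← smul_smul]
    exact (add_left_cancel h₂).symm
  have h₂ : ∀ x, β • X' (e x) = (β * σ⁻¹ * a) • e x := fun x => by
    have h₃ := congrArg X' (h₁ x)
    rw [map_smul, map_smul, hX'X, mul_comm, ← smul_smul] at h₃
    have h₄ : σ⁻¹ * a * (σ * a⁻¹) = 1 := by field_simp
    rw [mul_assoc, mul_comm β, ← smul_smul, h₃, smul_smul, h₄, one_smul]
  have h₃ := congrArg X' (hXX (A.unit false))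
  simp only [map_add, map_smul, hX'X, h₂] at h₃
  rw [hX, hX', rectAt_zero_unit, rectAt_zero_unit] at h₃
  have h₄ : e (A.unit false) = A.hunit false := by
    rw [he, LinearMap.comp_apply, unit, hunit, capAt_cupAt_succ (by omega)]
  rw [h₄] at h₃
  exact h₃.trans (by abel)

end IsQuadraticBraidingWith

/-- The crossings given by a `2`-box: the box itself, or its rotation, according to the shading. -/
noncomputable def crossingFamily (R : A.Box 2 false) : ∀ t, A.Box 2 t
  | false => R
  | true => A.rot R

theorem IsQuadraticBraidingWith.skeinRelations {σ a δ : ℂ} {R R' : A.Box 2 false}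
    (h : A.IsQuadraticBraidingWith σ R R' a) (hδ : A.HasModulus δ) (hσ : σ ≠ 0) {α β c : ℂ}
    (hα : α ≠ 0) (hq : A.stack R R = c • R + α • A.unit false + β • A.hunit false) :
    SkeinRelations (crossingFamily R) := by
  -- the rotations of `R` and of its inverse, up to Temperley-Lieb elements
  obtain ⟨q, r, hR₂⟩ : ∃ q r : ℂ,
      A.rotTwo R = (σ ^ 2)⁻¹ • R + q • A.unit false + r • A.hunit false := by
    obtain ⟨q, r, e⟩ := mem_span_of_mem_temperleyLieb hδ h.rotation
    refine ⟨-((σ ^ 2)⁻¹ * q), -((σ ^ 2)⁻¹ * r), ?_⟩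
    have e' : σ ^ 2 • A.rotTwo R = R - (q • A.unit false + r • A.hunit false) := by
      rw [← e]; abel
    rw [← inv_smul_smul₀ (pow_ne_zero 2 hσ) (A.rotTwo R), e']
    module
  obtain ⟨q₀, r₀, hR'⟩ : ∃ q₀ r₀ : ℂ,
      R' = α⁻¹ • R + q₀ • A.unit false + r₀ • A.hunit false := by
    have e := h.eq_combination_inv hσ hq
    refine ⟨-(α⁻¹ * c), -(α⁻¹ * (β * σ⁻¹ * a)), ?_⟩
    have e' : α • R' = R - (c • A.unit false + (β * σ⁻¹ * a) • A.hunit false) := by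
      rw [eq_sub_iff_add_eq, ← add_assoc]; exact e.symm
    rw [← inv_smul_smul₀ hα R', e']
    module
  have hR'₁ : A.rot R' = α⁻¹ • A.rot R + r₀ • A.unit (!false) + q₀ • A.hunit (!false) := by
    rw [hR']; exact rot_combination _ _ _ R
  obtain ⟨p, q₁, r₁, hp, hR'₂⟩ : ∃ p q₁ r₁ : ℂ, p ≠ 0 ∧
      A.rotTwo R' = p • R + q₁ • A.unit false + r₁ • A.hunit false := by
    refine ⟨α⁻¹ * (σ ^ 2)⁻¹, α⁻¹ * q + q₀, α⁻¹ * r + r₀,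
      mul_ne_zero (inv_ne_zero hα) (inv_ne_zero (pow_ne_zero 2 hσ)), ?_⟩
    have e : A.rotTwo R' = α⁻¹ • A.rotTwo R + q₀ • A.unit false + r₀ • A.hunit false := by
      rw [rotTwo, hR'₁]; exact rot_combination _ _ _ (A.rot R)
    rw [e, hR₂]
    module
  have hR'₃ : A.rot (A.rotTwo R') = p • A.rot R + r₁ • A.unit (!false) + q₁ • A.hunit (!false) := by
    rw [hR'₂]; exact rot_combination _ _ _ R
  have hf : ∀ {s i k}, shadeAt s i = false →
      (crossing (crossingFamily R) i : A.Box k s →ₗ[ℂ] A.Box k s) = rectAt i R :=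
    fun hb => crossing_eq _ hb
  have ht : ∀ {s i k}, shadeAt s i = true →
      (crossing (crossingFamily R) i : A.Box k s →ₗ[ℂ] A.Box k s) = rectAt i (A.rot R) :=
    fun hb => crossing_eq _ hb
  refine .of_rot hδ ?_ ?_ ?_ ?_
  · intro s k i hi
    cases hb : shadeAt s i
    · refine ⟨_, q, r, inv_ne_zero (pow_ne_zero 2 hσ), fun x => ?_⟩
      rw [hf hb, shadeAt_succ, hb, ← rectAt_combination hi hb.symm, ← hR₂]
      rfl
    · refine ⟨1, 0, 0, one_ne_zero, fun x => ?_⟩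
      rw [ht hb, shadeAt_succ, hb, one_smul, zero_smul, zero_smul, add_zero, add_zero]
      rfl
  · intro s i
    cases hb : shadeAt s i
    · refine ⟨a, fun x hi => ?_⟩
      rw [hf hb]
      exact capAt_rectAt_cupAt_of_capRight h.twist_left hi hb.symm x
    · refine ⟨σ * a⁻¹, fun x hi => ?_⟩
      rw [ht hb]
      exact capAt_rectAt_cupAt_of_capRight h.twist_top hi hb.symm x
  · intro s k i x hi
    cases hb : shadeAt s i
    · rw [hf hb, ← rectAt_stack (by omega) hb, hq, rectAt_combination hi hb.symm]
      exact Submodule.mem_span_triple.2 ⟨α, β, c, by abel⟩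
    · rw [ht hb]
      have e := h.rectAt_rot_rectAt_rot_inv hi hb x
      have e' : rectAt i (A.rot R) (cupAt i (capAt i x)) = a • cupAt i (capAt i x) :=
        rectAt_rot_cupAt (fun y => capAt_rectAt_cupAt_of_capRight h.twist_left (by omega)
          (by rw [shadeAt_succ, hb]; rfl) y) hi _
      rw [hR'₃, rectAt_combination (t := !false) hi hb.symm] at e
      simp only [map_add, map_smul, e'] at e
      refine Submodule.mem_span_triple.2 ⟨p⁻¹, -(p⁻¹ * (q₁ * a)), -(p⁻¹ * r₁), ?_⟩
      rw [← inv_smul_smul₀ hp (rectAt i (A.rot R) (rectAt i (A.rot R) x))]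
      nth_rewrite 1 [← e]
      module
  · intro s k i x hi
    refine Submodule.mem_span.2 fun W hW => ?_
    simp only [Set.insert_subset_iff, Set.singleton_subset_iff, SetLike.mem_coe] at hW
    obtain ⟨h₁, h₂, h₃, h₄, h₅, h₆, h₇, h₈, h₉, h₁₀, h₁₁, h₁₂, h₁₃, h₁₄⟩ := hW
    cases hb : shadeAt s i
    · have hb' : shadeAt s (i + 1) = true := by rw [shadeAt_succ, hb]; rfl
      rw [hf hb, ht hb'] at *
      -- the braid relation with the inverse expanded; both of its extreme terms have a non-zero
      -- coefficient, and it is solved for the one on the right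
      have e := h.rectAt_braid hσ hi hb x
      simp only [hR'₁, rectAt_combination (i := i + 1) (t := !false) hi hb'.symm, map_add,
        map_smul, smul_add, smul_smul] at e
      have e' : _ ∈ W := W.add_mem (W.add_mem (W.smul_mem α⁻¹ h₁) (W.smul_mem r₀ h₄))
        (W.smul_mem q₀ h₆)
      rw [e, W.add_mem_iff_left, W.add_mem_iff_left, W.add_mem_iff_left (W.smul_mem _ h₇),
        W.add_mem_iff_left (W.smul_mem _ h₂), W.smul_mem_iff] at e'
      · exact e'
      · exact mul_ne_zero hσ (mul_ne_zero (inv_ne_zero hα) (inv_ne_zero hα))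
      · exact W.add_mem (W.add_mem (W.smul_mem _ h₃) (W.smul_mem _ h₅)) (W.smul_mem _ h₁₁)
      · exact W.add_mem (W.add_mem (W.smul_mem _ h₈) (W.smul_mem _ h₁₀)) (W.smul_mem _ h₉)
    · have hb' : shadeAt s (i + 1) = false := by rw [shadeAt_succ, hb]; rfl
      rw [ht hb, hf hb'] at *
      -- here the turned braid relation is solved for the extreme term on the left
      have e := h.rectAt_braid_rot hσ hi hb x
      simp only [hR'₁, hR'₂, rectAt_combination (i := i + 1) (t := false) hi hb'.symm,
        rectAt_combination (i := i) (k := k) (t := !false) (by omega) hb.symm, map_add, map_smul,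
        smul_add, smul_smul] at e
      rw [← W.smul_mem_iff hp, ← W.add_mem_iff_left (W.smul_mem q₁ h₂),
        ← W.add_mem_iff_left (W.smul_mem r₁ h₇), e]
      refine W.add_mem (W.add_mem (W.add_mem (W.add_mem ?_ ?_) ?_)
        (W.add_mem (W.add_mem ?_ ?_) ?_)) (W.add_mem (W.add_mem ?_ ?_) ?_) <;>
      exact W.smul_mem _ ‹_›

/-- If `σ = 0`, the rotation relation says that `R` is a Temperley-Lieb element. -/
theorem IsQuadraticBraidingWith.mem_standard_of_sigma_eq_zero {σ a δ : ℂ} {R R' : A.Box 2 false}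
    (h : A.IsQuadraticBraidingWith σ R R' a) (hδ : A.HasModulus δ) (hσ : σ = 0) :
    R ∈ standard (fun _ => 0) false 2 := by
  have := h.rotation
  rw [hσ, zero_pow two_ne_zero, zero_smul, sub_zero] at this
  exact temperleyLieb_le_standard hδ _ _ this

end PlanarAlgebra
end Planar

theorem mainTheorem5 (A : Planar.PlanarAlgebra.{u}) (δ : ℂ) (hδ : A.HasModulus δ) (σ : ℂ)
    (R : A.Box 2 false) (hR : A.IsQuadraticBraiding σ R) :
    (A.generatedBy R).Evaluable := by
  obtain ⟨R', a, h⟩ := hR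
  obtain ⟨α, β, c, hq⟩ := h.exists_quadratic hδ
  by_cases hσ : σ = 0
  · exact Planar.PlanarAlgebra.skeinRelations_zero.evaluable hδ (h.mem_standard_of_sigma_eq_zero hδ hσ)
  by_cases hα : α = 0
  · refine Planar.PlanarAlgebra.skeinRelations_zero.evaluable hδ ?_
    rw [h.eq_combination_inv hσ hq, hα, zero_smul, zero_add]
    exact Submodule.add_mem _ (Submodule.smul_mem _ _ (Planar.PlanarAlgebra.unit_mem_standard _))
      (Submodule.smul_mem _ _ (Planar.PlanarAlgebra.hunit_mem_standard _))
  · refine (h.skeinRelations hδ hσ hα hq).evaluable hδ ?_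
    have hR := ((h.skeinRelations hδ hσ hα hq).stable hδ false 2).1 0 _ (by omega)
      (Planar.PlanarAlgebra.unit_mem_standard _)
    have e : Planar.PlanarAlgebra.crossing (Planar.PlanarAlgebra.crossingFamily R) 0
        (A.unit false) = R := Planar.PlanarAlgebra.rectAt_zero_unit R
    rwa [e] at hR
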